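/- Let $k$ be a field, $R$ a commutative noetherian domain that is a $k$-algebra, and $\sigma$ a $k$-algebra automorphism of $R$; write $\sigma$ also for the automorphism $\mathfrak p\mapsto\sigma^{-1}(\mathfrak p)$ of $X=\operatorname{Spec}R$. Let $Z\subseteq X$ be a closed subset that is $\sigma$-lonely, i.e. $Z\cap\sigma^i(Z)=\emptyset$ for all $0\ne i\in\mathbb Z$. A cycle is a finite formal sum $D=\sum_i a_iZ_i$ with $a_i\in\mathbb Z$ in symbols $Z_i$ ($i\in\mathbb Z$; $Z_i$ stands for $\sigma^{-i}(Z)$). Put $\sigma^j(D)=\sum_i a_iZ_{i-j}$, $D^+=\max(D,0)$ (coefficientwise), and for a cycle $G$ let $G_0=0$, $G_n=G+\sigma^{-1}(G)+\dots+\sigma^{-n+1}(G)$ and $G_{-n}=-\sigma(G)-\dots-\sigma^n(G)$ for $n\ge1$. The cycle $G=\sum_{i=m}^n a_iZ_i$ with $m\le n$ is pleasantly alternating if $a_m=a_n=1$ and its nonzero coefficients alternate strictly between $1$ and $-1$; it is trivial if $G=Z_i$ for some $i$. Let $H,J$ be ideals of $R$ with $V(H)\subseteq Z$ and $V(J)\subseteq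 Z$. For a cycle $D=\sum_i a_iZ_i\ge0$ put $H[D]=\prod_i\sigma^i(H)^{a_i}$, similarly $J[D]$, and for any cycle $C$ put $I(C)=H[(-C)^+]\,J[C^+]$. Let $R[t,t^{-1};\sigma]$ be the skew Laurent ring with $t\,r=\sigma(r)\,t$, graded by $\deg t=1$, and let $$B(G,H,J)=\bigoplus_{n\in\mathbb Z}I(G_n)\,t^n\subseteq R[t,t^{-1};\sigma],$$ a graded subring. **Proposition.** Let $G$ be a pleasantly alternating cycle and $i\in\mathbb Z$. Put $\widetilde G=Z_i$, $B=B(G,H,J)$ and $A=B(Z_i,H,J)$. Then $A$ and $B$ are graded Morita equivalent: there is a $k$-linear equivalence between the categories of right $A$-modules and of right $B$-modules which restricts to an equivalence between the categories of $\mathbb Z$-graded right modules (with degree-preserving homomorphisms). The equivalence is implemented by graded bimodules, as follows. There is a cycle $D$ with $G=Z_i+\sigma^{-1}(D)-D$, and the subspaces $$N=\bigoplus_{n}I(\widetilde G_n-D)\,t^n,\qquad P=\bigoplus_{n}I(\widetilde G_n+\sigma^{-n}(D))\,t^n$$ of $R[t,t^{-1};\sigma]$ are a $(B,A)$-bimodule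 and an $(A,B)$-bimodule such that: 1. $NP=B$ and $PN=A$; 2. $rN\subseteq A$ for some $0\ne r\in R$, so that $N$ is isomorphic, as a graded right $A$-module, to the graded right ideal $rN$ of $A$; 3. left multiplication gives an isomorphism $B\to\operatorname{End}_A(N_A)$ and a bijection $P\to\operatorname{Hom}_A(N_A,A_A)$; 4. the equivalence from right $A$-modules to right $B$-modules is isomorphic to $\operatorname{Hom}_A(N,-)$ and its inverse to $\operatorname{Hom}_B(P,-)$; for a graded right $A$-module $X$, the elements of degree $n$ of $\operatorname{Hom}_A(N,X)$ are the homomorphisms that map $N_m$ into $X_{n+m}$ for all $m$. -/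

import Mathlib

open CategoryTheory

universe w u

noncomputable section

namespace LonelyCycles

/-! ### Cycles on an orbit -/

/-- Cycles on the orbit of `Z`: elements `∑ aᵢ Zᵢ` of the free abelian group on formal symbols
`Zᵢ`, `i ∈ ℤ`. -/
abbrev Cycle : Type := ℤ →₀ ℤ

/-- The trivial cycle `Zᵢ`. -/
def Cycle.pt (i : ℤ) : Cycle := Finsupp.single i 1

/-- The cycle `σ^j(D) = ∑ aᵢ Z_{i-j}`, where `D = ∑ aᵢ Zᵢ`. -/
def Cycle.shift (j : ℤ) (D : Cycle) : Cycle := Finsupp.equivMapDomain (Equiv.subRight j) D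

@[simp]
theorem Cycle.shift_apply (j : ℤ) (D : Cycle) (i : ℤ) : Cycle.shift j D i = D (j + i) := by
  simp [Cycle.shift, Finsupp.equivMapDomain_apply, add_comm]

/-- The cycle `G_n`: `G_n = G + σ⁻¹(G) + ⋯ + σ^{-n+1}(G)` for `n ≥ 0` and
`G_{-n} = -σ(G) - σ²(G) - ⋯ - σⁿ(G)` for `n ≥ 1`. -/
def Cycle.partialSum (G : Cycle) : ℤ → Cycle
  | Int.ofNat n => ∑ j ∈ Finset.range n, Cycle.shift (-(j : ℤ)) G
  | Int.negSucc n => -∑ j ∈ Finset.range (n + 1), Cycle.shift ((j : ℤ) + 1) G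

/-- `G = ∑_{i=m}^n aᵢ Zᵢ` with `m ≤ n` and `a_m = a_n = 1`, where the nonzero coefficients
alternate strictly between `1` and `-1`. -/
def Cycle.IsPleasantlyAlternating (G : Cycle) : Prop :=
  ∃ m n : ℤ, m ≤ n ∧ (∀ i, G i ≠ 0 → m ≤ i ∧ i ≤ n) ∧ G m = 1 ∧ G n = 1 ∧
    (∀ i, G i = -1 ∨ G i = 0 ∨ G i = 1) ∧
    ∀ i j, i < j → G i ≠ 0 → G j ≠ 0 → (∀ l, i < l → l < j → G l = 0) → G j = -G i

theorem Cycle.partialSum_succ (G : Cycle) (n : ℤ) :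
    G.partialSum (n + 1) = G.partialSum n + Cycle.shift (-n) G := by
  rcases n with n | n
  · change ∑ j ∈ Finset.range (n + 1), Cycle.shift (-(j : ℤ)) G = _
    rw [Finset.sum_range_succ]; rfl
  · rcases n with _ | n
    · change ∑ j ∈ Finset.range 0, Cycle.shift (-(j : ℤ)) G
        = -∑ j ∈ Finset.range 1, Cycle.shift ((j : ℤ) + 1) G + Cycle.shift 1 G
      simp
    · have h : Int.negSucc (n + 1) + 1 = Int.negSucc n := by omega
      rw [h]
      change -∑ j ∈ Finset.range (n + 1), Cycle.shift ((j : ℤ) + 1) G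
        = -∑ j ∈ Finset.range (n + 1 + 1), Cycle.shift ((j : ℤ) + 1) G
          + Cycle.shift (((n + 1 : ℕ) : ℤ) + 1) G
      rw [Finset.sum_range_succ _ (n + 1)]
      abel

theorem Cycle.partialSum_zero (G : Cycle) : G.partialSum 0 = 0 := by
  change ∑ j ∈ Finset.range 0, Cycle.shift (-(j : ℤ)) G = 0
  simp

theorem Cycle.partialSum_add (G : Cycle) (m n : ℤ) :
    G.partialSum (m + n) = G.partialSum m + Cycle.shift (-m) (G.partialSum n) := by
  induction n using Int.induction_on with
  | zero => ext i; simp [Cycle.partialSum_zero]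
  | succ n ih =>
    rw [← add_assoc, Cycle.partialSum_succ, ih, Cycle.partialSum_succ]
    ext i
    simp only [Finsupp.add_apply, Cycle.shift_apply]
    rw [show -(m + (n : ℤ)) + i = -(n : ℤ) + (-m + i) by ring]
    ring
  | pred n ih =>
    have h1 := Cycle.partialSum_succ G (m + (-(n : ℤ) - 1))
    have h2 := Cycle.partialSum_succ G (-(n : ℤ) - 1)
    rw [show m + (-(n : ℤ) - 1) + 1 = m + -(n : ℤ) by ring, ih] at h1
    rw [show (-(n : ℤ) - 1) + 1 = -(n : ℤ) by ring] at h2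
    rw [h2] at h1
    ext i
    have h3 := DFunLike.congr_fun h1 i
    simp only [Finsupp.add_apply, Cycle.shift_apply] at h3 ⊢
    rw [show -(m + (-(n : ℤ) - 1)) + i = -(-(n : ℤ) - 1) + (-m + i) by ring] at h3
    linarith

variable {k : Type w} {R : Type u} [Field k] [CommRing R] [Algebra k R]

/-! ### Lonely closed sets -/

/-- The automorphism `σ^i` of `X = Spec R` corresponding to the automorphism `σ^i` of `R`. -/
def specAut (σ : R ≃ₐ[k] R) (i : ℤ) : PrimeSpectrum R → PrimeSpectrum R :=
  PrimeSpectrum.comap ((σ ^ i : R ≃ₐ[k] R) : R →+* R)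

/-- `Z` is `σ`-lonely: `Z ∩ σ^i(Z) = ∅` for all `i ≠ 0`. -/
def IsLonely (σ : R ≃ₐ[k] R) (Z : Set (PrimeSpectrum R)) : Prop :=
  ∀ i : ℤ, i ≠ 0 → Z ∩ specAut σ i '' Z = ∅

/-! ### The ideals attached to cycles -/

/-- The ideal `H[D] = ∏ᵢ σ^i(H)^{aᵢ}` of `R`, for an effective cycle `D = ∑ aᵢ Zᵢ`. -/
def cycleIdeal (σ : R ≃ₐ[k] R) (H : Ideal R) (D : Cycle) : Ideal R :=
  ∏ i ∈ D.support, (H.map (σ ^ i : R ≃ₐ[k] R)) ^ (D i).toNat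

/-- If all the coefficients of `D` are `0` or `1`, then `H[D]` is the product of the `σ^i(H)` over
all `i` such that `aᵢ = 1`. -/
theorem cycleIdeal_eq (σ : R ≃ₐ[k] R) (H : Ideal R) (D : Cycle) (hD : ∀ i, D i = 0 ∨ D i = 1) :
    cycleIdeal σ H D = ∏ᶠ (i : ℤ) (_ : D i = 1), H.map (σ ^ i : R ≃ₐ[k] R) := by
  have h : ∀ i, D i = 1 ↔ i ∈ D.support := fun i => by
    rcases hD i with h | h <;> simp [h]
  simp_rw [h]
  rw [finprod_mem_finset_eq_prod]
  refine Finset.prod_congr rfl fun i hi => ?_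
  rw [(h i).2 hi]
  simp

theorem cycleIdeal_eq_prod (σ : R ≃ₐ[k] R) (H : Ideal R) (D : Cycle) (s : Finset ℤ)
    (hs : D.support ⊆ s) :
    cycleIdeal σ H D = ∏ i ∈ s, (H.map (σ ^ i : R ≃ₐ[k] R)) ^ (D i).toNat := by
  refine Finset.prod_subset hs fun i _ hi => ?_
  rw [Finsupp.notMem_support_iff.1 hi]
  simp

theorem map_cycleIdeal (σ : R ≃ₐ[k] R) (H : Ideal R) (D : Cycle) (m : ℤ) :
    (cycleIdeal σ H D).map (σ ^ m : R ≃ₐ[k] R) = cycleIdeal σ H (Cycle.shift (-m) D) := by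
  have hsupp : (Cycle.shift (-m) D).support
      = D.support.map (Equiv.addRight m).toEmbedding := by
    ext i
    simp only [Finsupp.mem_support_iff, Cycle.shift_apply, Finset.mem_map_equiv,
      Equiv.addRight_symm, Equiv.coe_addRight]
    rw [add_comm]
  have hprod := map_prod (Ideal.mapHom (σ ^ m : R ≃ₐ[k] R))
    (fun i => (H.map (σ ^ i : R ≃ₐ[k] R)) ^ (D i).toNat) D.support
  simp only [Ideal.mapHom_apply] at hprod
  rw [cycleIdeal, cycleIdeal, hsupp, Finset.prod_map, hprod]
  refine Finset.prod_congr rfl fun i _ => ?_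
  rw [Ideal.map_pow]
  simp only [Equiv.coe_toEmbedding, Equiv.coe_addRight, Cycle.shift_apply]
  rw [show -m + (i + m) = i by ring]
  congr 1
  ext x
  simp only [Ideal.mem_map_of_equiv]
  constructor
  · rintro ⟨_, ⟨y, hy, rfl⟩, rfl⟩
    exact ⟨y, hy, by rw [add_comm, zpow_add]; rfl⟩
  · rintro ⟨y, hy, rfl⟩
    exact ⟨_, ⟨y, hy, rfl⟩, by rw [add_comm, zpow_add]; rfl⟩

theorem cycleIdeal_mul_le (σ : R ≃ₐ[k] R) (H : Ideal R) (D E F : Cycle)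
    (h : ∀ i, (F i).toNat ≤ (D i).toNat + (E i).toNat) :
    cycleIdeal σ H D * cycleIdeal σ H E ≤ cycleIdeal σ H F := by
  classical
  set s := D.support ∪ E.support ∪ F.support
  rw [cycleIdeal_eq_prod σ H D s (fun i hi => by simp [s] at hi ⊢; tauto),
    cycleIdeal_eq_prod σ H E s (fun i hi => by simp [s] at hi ⊢; tauto),
    cycleIdeal_eq_prod σ H F s (fun i hi => by simp [s] at hi ⊢; tauto),
    ← Finset.prod_mul_distrib]
  refine Finset.prod_le_prod' fun i _ => ?_
  rw [← pow_add]
  exact Ideal.pow_le_pow_right (h i)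
  
/-- The ideal `H[(-C)⁺] J[C⁺]`, where `D⁺ = max(D, 0)`. -/
def twoSidedIdeal (σ : R ≃ₐ[k] R) (H J : Ideal R) (C : Cycle) : Ideal R :=
  cycleIdeal σ H ((-C) ⊔ 0) * cycleIdeal σ J (C ⊔ 0)

theorem twoSidedIdeal_zero (σ : R ≃ₐ[k] R) (H J : Ideal R) : twoSidedIdeal σ H J 0 = ⊤ := by
  simp [twoSidedIdeal, cycleIdeal]

theorem twoSidedIdeal_mul_le (σ : R ≃ₐ[k] R) (H J : Ideal R) (C E : Cycle) (m : ℤ) :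
    twoSidedIdeal σ H J C * (twoSidedIdeal σ H J E).map (σ ^ m : R ≃ₐ[k] R)
      ≤ twoSidedIdeal σ H J (C + Cycle.shift (-m) E) := by
  rw [twoSidedIdeal, twoSidedIdeal, twoSidedIdeal, Ideal.map_mul, map_cycleIdeal, map_cycleIdeal,
    mul_mul_mul_comm]
  refine Ideal.mul_mono (cycleIdeal_mul_le _ _ _ _ _ fun i => ?_)
    (cycleIdeal_mul_le _ _ _ _ _ fun i => ?_)
  · simp only [Finsupp.sup_apply, Finsupp.neg_apply, Finsupp.add_apply, Cycle.shift_apply,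
      Finsupp.zero_apply]
    omega
  · simp only [Finsupp.sup_apply, Finsupp.add_apply, Cycle.shift_apply, Finsupp.zero_apply]
    omega

/-! ### The skew Laurent ring `R[t, t⁻¹; σ]` -/

/-- The action of `ℤ` on `R` through the powers of `σ`. -/
abbrev zpowAction (σ : R ≃ₐ[k] R) : MulSemiringAction (Multiplicative ℤ) R :=
  MulSemiringAction.compHom R (zpowersHom (R ≃ₐ[k] R) σ)

/-- The skew Laurent ring `U = R[t, t⁻¹; σ]`: its elements are the finite sums `∑ rₙ tⁿ` with
coefficients in `R` on the left, and `(r t^m) (s t^n) = r σ^m(s) t^{m+n}`. -/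
def SkewLaurent (_σ : R ≃ₐ[k] R) : Type u := SkewMonoidAlgebra R (Multiplicative ℤ)

namespace SkewLaurent

variable (σ : R ≃ₐ[k] R)

instance : Ring (SkewLaurent σ) :=
  @SkewMonoidAlgebra.instRing R (Multiplicative ℤ) _ _ (zpowAction σ)

instance : Algebra k (SkewLaurent σ) :=
  @SkewMonoidAlgebra.instAlgebraOfSMulCommClass k (Multiplicative ℤ) _ _ R _ _ (zpowAction σ)
    (@SMulCommClass.mk _ _ _ (zpowAction σ).toSMul _
      fun m c r => map_smul (σ ^ m.toAdd : R ≃ₐ[k] R) c r)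

/-- The monomial `r tⁿ`. -/
def monomial (n : ℤ) (r : R) : SkewLaurent σ :=
  SkewMonoidAlgebra.single (Multiplicative.ofAdd n) r

/-- The coefficient of `tⁿ`, as a `k`-linear map. -/
def coeff (n : ℤ) : SkewLaurent σ →ₗ[k] R where
  toFun x := SkewMonoidAlgebra.coeff x (Multiplicative.ofAdd n)
  map_add' x y := DFunLike.congr_fun
    (SkewMonoidAlgebra.coeff_add (k := R) (G := Multiplicative ℤ) x y) _
  map_smul' c x := DFunLike.congr_fun
    (SkewMonoidAlgebra.coeff_smul (k := R) (G := Multiplicative ℤ) c x) _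

variable {σ}

theorem ext {x y : SkewLaurent σ} (h : ∀ n, coeff σ n x = coeff σ n y) : x = y :=
  SkewMonoidAlgebra.ext fun a => h a.toAdd

theorem coeff_monomial (m n : ℤ) (r : R) :
    coeff σ n (monomial σ m r) = if m = n then r else 0 := by
  classical
  exact SkewMonoidAlgebra.coeff_single_apply

theorem coeff_one (n : ℤ) : coeff σ n 1 = if (0 : ℤ) = n then 1 else 0 :=
  coeff_monomial 0 n 1

theorem monomial_mul_monomial (m n : ℤ) (r s : R) :
    monomial σ m r * monomial σ n s = monomial σ (m + n) (r * (σ ^ m : R ≃ₐ[k] R) s) := by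
  let := zpowAction σ
  exact SkewMonoidAlgebra.single_mul_single

/-- A product lies in `⊕ Kₙ tⁿ` as soon as the products of the coefficients do. -/
theorem coeff_mul_mem (K : ℤ → Ideal R) (x y : SkewLaurent σ)
    (h : ∀ m n, coeff σ m x * (σ ^ m : R ≃ₐ[k] R) (coeff σ n y) ∈ K (m + n)) (l : ℤ) :
    coeff σ l (x * y) ∈ K l := by
  classical
  let := zpowAction σ
  have e : coeff σ l (x * y) = _ :=
    SkewMonoidAlgebra.coeff_mul (k := R) (G := Multiplicative ℤ) x y (Multiplicative.ofAdd l)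
  rw [e]
  refine Ideal.sum_mem _ fun a _ => Ideal.sum_mem _ fun b _ => ?_
  dsimp only
  split_ifs with hab
  · have h1 := h a.toAdd b.toAdd
    have h2 : a.toAdd + b.toAdd = l := by rw [← toAdd_mul, hab]; rfl
    rw [h2] at h1
    exact h1
  · exact Ideal.zero_mem _

variable (σ)

/-- The `k`-subspace `⊕ Kₙ tⁿ` of `R[t, t⁻¹; σ]`, for ideals `Kₙ` of `R`. -/
def ofIdeals (K : ℤ → Ideal R) : Submodule k (SkewLaurent σ) where
  carrier := {x | ∀ n, coeff σ n x ∈ K n}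
  add_mem' hx hy n := by rw [map_add]; exact add_mem (hx n) (hy n)
  zero_mem' n := by rw [map_zero]; exact Ideal.zero_mem _
  smul_mem' c x hx n := by
    rw [map_smul, Algebra.smul_def]
    exact Ideal.mul_mem_left _ _ (hx n)

/-- The homogeneous elements of degree `n`, that is, the monomials `r tⁿ`. -/
def homogeneous (n : ℤ) : Submodule k (SkewLaurent σ) where
  carrier := {x | ∀ m, m ≠ n → coeff σ m x = 0}
  add_mem' hx hy m hm := by rw [map_add, hx m hm, hy m hm, add_zero]
  zero_mem' m _ := map_zero _
  smul_mem' c x hx m hm := by rw [map_smul, hx m hm, smul_zero]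

end SkewLaurent

/-! ### The rings `B(G, H, J)` -/

/-- The ring `B(G, H, J) = ⊕ Iₙ tⁿ ⊆ R[t, t⁻¹; σ]`, where `Iₙ = H[(-Gₙ)⁺] J[Gₙ⁺]`. -/
def ringB (σ : R ≃ₐ[k] R) (G : Cycle) (H J : Ideal R) : Subalgebra k (SkewLaurent σ) where
  __ := SkewLaurent.ofIdeals σ fun n => twoSidedIdeal σ H J (G.partialSum n)
  mul_mem' := fun {x y} hx hy =>
    SkewLaurent.coeff_mul_mem (fun n => twoSidedIdeal σ H J (G.partialSum n)) x y fun m n => by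
      rw [Cycle.partialSum_add]
      exact twoSidedIdeal_mul_le σ H J _ _ m
        (Ideal.mul_mem_mul (hx m) (Ideal.mem_map_of_mem _ (hy n)))
  algebraMap_mem' c := by
    change ∀ n, _ ∈ _
    intro n
    rw [Algebra.algebraMap_eq_smul_one, map_smul, SkewLaurent.coeff_one]
    split_ifs with h
    · rw [← h, Cycle.partialSum_zero, twoSidedIdeal_zero]; trivial
    · rw [smul_zero]; exact Ideal.zero_mem _

/-- The `ℤ`-grading of `B(G, H, J)`, with `degree t = 1`. -/
def ringB.grading (σ : R ≃ₐ[k] R) (G : Cycle) (H J : Ideal R) (n : ℤ) :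
    Submodule k (ringB σ G H J) :=
  (SkewLaurent.homogeneous σ n).comap (ringB σ G H J).val.toLinearMap

theorem ringB.monomial_mem (σ : R ≃ₐ[k] R) (G : Cycle) (H J : Ideal R) (x : ringB σ G H J)
    (n : ℤ) : SkewLaurent.monomial σ n (SkewLaurent.coeff σ n x) ∈ ringB σ G H J := by
  intro m
  rw [SkewLaurent.coeff_monomial]
  split_ifs with h
  · subst h; exact x.2 n
  · exact Ideal.zero_mem _

theorem ringB.isInternal (σ : R ≃ₐ[k] R) (G : Cycle) (H J : Ideal R) :
    DirectSum.IsInternal (ringB.grading σ G H J) := by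
  classical
  have key : ∀ (f : DirectSum ℤ fun n => ringB.grading σ G H J n) (n : ℤ),
      SkewLaurent.coeff σ n (DirectSum.coeAddMonoidHom (ringB.grading σ G H J) f : ringB σ G H J)
        = SkewLaurent.coeff σ n (f n : ringB σ G H J) := by
    intro f n
    induction f using DirectSum.induction_on with
    | zero => simp
    | of i y =>
      rw [DirectSum.coeAddMonoidHom_of]
      by_cases h : i = n
      · subst h; rw [DirectSum.of_eq_same]
      · rw [DirectSum.of_eq_of_ne _ _ _ (Ne.symm h)]
        have hy := y.2 n (Ne.symm h)
        simpa using hy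
    | add f g hf hg =>
      rw [map_add, DirectSum.add_apply]
      simp only [Subalgebra.coe_add, Submodule.coe_add, map_add, hf, hg]
  refine ⟨(injective_iff_map_eq_zero _).2 fun f hf => ?_, fun x => ?_⟩
  · ext n : 3
    refine SkewLaurent.ext fun m => ?_
    by_cases h : m = n
    · subst h
      rw [← key f m, hf]
      rfl
    · have hm := (f n).2 m h
      simpa using hm
  · refine ⟨∑ a ∈ SkewMonoidAlgebra.support (k := R) (G := Multiplicative ℤ) x.1,
      DirectSum.of (fun n => ringB.grading σ G H J n) a.toAdd
        ⟨⟨_, ringB.monomial_mem σ G H J x a.toAdd⟩, fun m hm => ?_⟩, ?_⟩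
    · exact (SkewLaurent.coeff_monomial _ _ _).trans (if_neg (Ne.symm hm))
    · rw [map_sum]
      simp only [DirectSum.coeAddMonoidHom_of]
      apply Subtype.ext
      refine SkewLaurent.ext fun n => ?_
      rw [AddSubmonoidClass.coe_finsetSum, map_sum]
      simp only [SkewLaurent.coeff_monomial]
      rw [Finset.sum_eq_single (Multiplicative.ofAdd n)]
      · exact if_pos rfl
      · intro b _ hb
        exact if_neg fun h => hb (by rw [← h]; rfl)
      · intro hn
        exact (if_pos rfl).trans (SkewMonoidAlgebra.notMem_support_iff.1 hn)

instance (σ : R ≃ₐ[k] R) (G : Cycle) (H J : Ideal R) :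
    GradedAlgebra (ringB.grading σ G H J) where
  one_mem m hm := (SkewLaurent.coeff_one m).trans (if_neg (Ne.symm hm))
  mul_mem i j x y hx hy l hl := by
    classical
    have h := SkewLaurent.coeff_mul_mem (fun l => if l = i + j then ⊤ else ⊥) (x : SkewLaurent σ) y
      (fun m n => ?_) l
    · rw [if_neg hl] at h; exact h
    · split_ifs with hmn
      · trivial
      · by_cases hm : m = i
        · have hn : n ≠ j := by rintro rfl; exact hmn (by rw [hm])
          rw [show SkewLaurent.coeff σ n (y : SkewLaurent σ) = 0 from hy n hn, map_zero, mul_zero]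
          exact Ideal.zero_mem _
        · rw [show SkewLaurent.coeff σ m (x : SkewLaurent σ) = 0 from hx m hm, zero_mul]
          exact Ideal.zero_mem _
  __ := (ringB.isInternal σ G H J).chooseDecomposition

/-! ### Graded Morita equivalences of `ℤ`-graded algebras -/

section Morita

variable {A B : Type u} [Ring A] [Algebra k A] [Ring B] [Algebra k B]

/-- A `ℤ`-graded right module over the `ℤ`-graded algebra `A = ⊕ 𝒜 n`. -/
structure GrModuleCat (𝒜 : ℤ → Submodule k A) [GradedAlgebra 𝒜] where
  /-- the underlying right `A`-module -/
  mod : ModuleCat.{u} Aᵐᵒᵖ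
  /-- the homogeneous elements of degree `n` -/
  deg : ℤ → AddSubgroup mod
  isInternal : DirectSum.IsInternal deg
  smul_mem : ∀ m n : ℤ, ∀ x ∈ deg m, ∀ a ∈ 𝒜 n, MulOpposite.op a • x ∈ deg (m + n)

namespace GrModuleCat

variable {𝒜 : ℤ → Submodule k A} [GradedAlgebra 𝒜]

/-- The morphisms of graded modules are the module homomorphisms that preserve degrees. -/
@[ext]
structure Hom (X Y : GrModuleCat 𝒜) where
  hom : X.mod ⟶ Y.mod
  map_deg : ∀ n : ℤ, ∀ x ∈ X.deg n, hom.hom x ∈ Y.deg n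

instance : Category (GrModuleCat 𝒜) where
  Hom := Hom
  id X := ⟨𝟙 X.mod, fun _ _ hx => hx⟩
  comp f g := ⟨f.hom ≫ g.hom, fun n x hx => g.map_deg n _ (f.map_deg n x hx)⟩

variable (𝒜) in
/-- The functor that forgets the grading. -/
def forget : GrModuleCat 𝒜 ⥤ ModuleCat.{u} Aᵐᵒᵖ where
  obj X := X.mod
  map f := f.hom

end GrModuleCat

/-- A graded Morita equivalence: a `k`-linear equivalence of the categories of all right modules,
together with an equivalence of the categories of graded right modules to which it restricts. -/
structure GradedMoritaEquivalence (𝒜 : ℤ → Submodule k A) [GradedAlgebra 𝒜]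
    (ℬ : ℤ → Submodule k B) [GradedAlgebra ℬ] where
  morita : MoritaEquivalence k Aᵐᵒᵖ Bᵐᵒᵖ
  graded : GrModuleCat 𝒜 ≌ GrModuleCat ℬ
  restricts : graded.functor ⋙ GrModuleCat.forget ℬ ≅ GrModuleCat.forget 𝒜 ⋙ morita.eqv.functor

/-- For a `(B, A)`-bimodule `N` and a right `A`-module `X`, the right `B`-module `Hom_A(N, X)` of
right `A`-module homomorphisms, with `(f b)(x) = f(b x)`. -/
def RHom (A B N X : Type u) [Ring A] [Ring B] [AddCommGroup N] [Module B N] [Module Aᵐᵒᵖ N]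
    [SMulCommClass B Aᵐᵒᵖ N] [AddCommGroup X] [Module Aᵐᵒᵖ X] : Type u :=
  N →ₗ[Aᵐᵒᵖ] X

section RHom

variable (A B) (N X : Type u) [AddCommGroup N] [Module B N] [Module Aᵐᵒᵖ N]
  [SMulCommClass B Aᵐᵒᵖ N] [AddCommGroup X] [Module Aᵐᵒᵖ X]

instance : AddCommGroup (RHom A B N X) := inferInstanceAs (AddCommGroup (N →ₗ[Aᵐᵒᵖ] X))

instance : FunLike (RHom A B N X) N X := inferInstanceAs (FunLike (N →ₗ[Aᵐᵒᵖ] X) N X)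

variable {A B N X} in
theorem RHom.ext {f g : RHom A B N X} (h : ∀ x, f x = g x) : f = g := LinearMap.ext h

instance : Module Bᵐᵒᵖ (RHom A B N X) where
  smul b f := LinearMap.comp (show N →ₗ[Aᵐᵒᵖ] X from f) (Module.toModuleEnd Aᵐᵒᵖ N b.unop)
  one_smul f := RHom.ext fun x => congrArg f (one_smul B x)
  mul_smul b c f := RHom.ext fun x => congrArg f (mul_smul c.unop b.unop x)
  smul_zero _ := rfl
  smul_add _ _ _ := rfl
  add_smul b c f := RHom.ext fun x =>
    (congrArg f (add_smul b.unop c.unop x)).trans (LinearMap.map_add (show N →ₗ[Aᵐᵒᵖ] X from f) _ _)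
  zero_smul f := RHom.ext fun x =>
    (congrArg f (zero_smul B x)).trans (LinearMap.map_zero (show N →ₗ[Aᵐᵒᵖ] X from f))

theorem RHom.smul_apply (b : B) (f : RHom A B N X) (x : N) :
    (MulOpposite.op b • f) x = f (b • x) := rfl

variable {A B N X} in
/-- The homomorphism `f : N → X` has degree `n`: it maps `N_m` to `X_{n+m}` for all `m`. -/
def RHom.HasDegree (degN : ℤ → Set N) (degX : ℤ → AddSubgroup X) (n : ℤ) (f : RHom A B N X) :
    Prop :=
  ∀ m : ℤ, ∀ x ∈ degN m, f x ∈ degX (n + m)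

/-- Composition with a homomorphism `X → Y`, as a map `Hom_A(N, X) → Hom_A(N, Y)`. -/
def RHom.map {Y : Type u} [AddCommGroup Y] [Module Aᵐᵒᵖ Y] (φ : X →ₗ[Aᵐᵒᵖ] Y) :
    RHom A B N X →ₗ[Bᵐᵒᵖ] RHom A B N Y where
  toFun f := φ.comp (show N →ₗ[Aᵐᵒᵖ] X from f)
  map_add' _ _ := LinearMap.comp_add _ _ _
  map_smul' _ _ := rfl

/-- The functor `Hom_A(N, -)` from right `A`-modules to right `B`-modules. -/
def rHomFunctor : ModuleCat.{u} Aᵐᵒᵖ ⥤ ModuleCat.{u} Bᵐᵒᵖ where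
  obj Y := ModuleCat.of Bᵐᵒᵖ (RHom A B N Y)
  map φ := ModuleCat.ofHom (RHom.map A B N _ φ.hom)
  map_id _ := rfl
  map_comp _ _ := rfl

end RHom

/-- The graded Morita equivalence `E` is implemented by the `(B, A)`-bimodule `N`, graded by the
sets `degN n` of its homogeneous elements of degree `n`, and by the `(A, B)`-bimodule `P`: the
equivalence is `Hom_A(N, -)`, its inverse is `Hom_B(P, -)`, and for a graded module `X` the
elements of degree `n` of `Hom_A(N, X)` are the homomorphisms of degree `n`. -/
def GradedMoritaEquivalence.IsImplementedBy {𝒜 : ℤ → Submodule k A} [GradedAlgebra 𝒜]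
    {ℬ : ℤ → Submodule k B} [GradedAlgebra ℬ] (E : GradedMoritaEquivalence 𝒜 ℬ)
    (N P : Type u) [AddCommGroup N] [Module B N] [Module Aᵐᵒᵖ N] [SMulCommClass B Aᵐᵒᵖ N]
    [AddCommGroup P] [Module A P] [Module Bᵐᵒᵖ P] [SMulCommClass A Bᵐᵒᵖ P]
    (degN : ℤ → Set N) : Prop :=
  (∃ φ : E.morita.eqv.functor ≅ rHomFunctor A B N,
    ∀ (X : GrModuleCat 𝒜) (n : ℤ) (y : (E.graded.functor.obj X).mod),
      y ∈ (E.graded.functor.obj X).deg n ↔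
        RHom.HasDegree (A := A) (B := B) degN X.deg n
          ((φ.hom.app X.mod).hom ((E.restricts.hom.app X).hom y))) ∧
  Nonempty (E.morita.eqv.inverse ≅ rHomFunctor B A P)

end Morita

/-! ### Bimodules inside a ring -/

/-- A `(B, A)`-bimodule contained in a ring `U`, for subalgebras `A` and `B` of `U`. -/
structure SubBimodule {U : Type u} [Ring U] [Algebra k U] (B A : Subalgebra k U) where
  /-- the underlying `k`-subspace -/
  space : Submodule k U
  left_mem : ∀ b ∈ B, ∀ x ∈ space, b * x ∈ space
  right_mem : ∀ a ∈ A, ∀ x ∈ space, x * a ∈ space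

namespace SubBimodule

variable {U : Type u} [Ring U] [Algebra k U] {B A : Subalgebra k U} (N : SubBimodule B A)

/-- The elements of `N`. -/
def Elt : Type u := N.space

instance : AddCommGroup N.Elt := inferInstanceAs (AddCommGroup N.space)

/-- The inclusion of `N` into `U`. -/
def incl : N.Elt →+ U := N.space.subtype.toAddMonoidHom

instance : Module B N.Elt where
  smul b x := ⟨b.1 * x.1, N.left_mem _ b.2 _ x.2⟩
  one_smul x := Subtype.ext (one_mul x.1)
  mul_smul b c x := Subtype.ext (mul_assoc b.1 c.1 x.1)
  smul_zero b := Subtype.ext (mul_zero b.1)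
  smul_add b x y := Subtype.ext (mul_add b.1 x.1 y.1)
  add_smul b c x := Subtype.ext (add_mul b.1 c.1 x.1)
  zero_smul x := Subtype.ext (zero_mul x.1)

instance : Module Aᵐᵒᵖ N.Elt where
  smul a x := ⟨x.1 * a.unop.1, N.right_mem _ a.unop.2 _ x.2⟩
  one_smul x := Subtype.ext (mul_one x.1)
  mul_smul b c x := Subtype.ext (mul_assoc x.1 c.unop.1 b.unop.1).symm
  smul_zero b := Subtype.ext (zero_mul b.unop.1)
  smul_add b x y := Subtype.ext (add_mul x.1 y.1 b.unop.1)
  add_smul b c x := Subtype.ext (mul_add x.1 b.unop.1 c.unop.1)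
  zero_smul x := Subtype.ext (mul_zero x.1)

instance : SMulCommClass B Aᵐᵒᵖ N.Elt where
  smul_comm b a x := Subtype.ext (mul_assoc b.1 x.1 a.unop.1).symm

/-- The homomorphism `B → End(N_A)` given by left multiplication. -/
def toEnd : B →+* Module.End Aᵐᵒᵖ N.Elt := Module.toModuleEnd Aᵐᵒᵖ N.Elt

end SubBimodule

end LonelyCycles

end

/-!
The three rings and bimodules have one shape. For cycles `X` and `Y` let
`M(X, Y) = ⊕ I(G_n + σ⁻ⁿ(Y) - X) tⁿ` with `G = Zᵢ` (`homSpace`). The cocycle identity for `G_n` and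
the inclusions `I(C) σ^m(I(E)) ⊆ I(C + σ⁻ᵐ(E))` give `M(X, Y) M(Y, W) ⊆ M(X, W)`
(`mul_mem_homSpace`). Moreover `A = M(0, 0)`, and if `G = Zᵢ + σ⁻¹(D) - D` then `B = M(D, D)`,
`N = M(D, 0)` and `P = M(0, D)`.

The cycle `D` has the coefficients `[i ≤ l] - ∑_{j ≤ l} G_j`
(`Cycle.IsPleasantlyAlternating.exists_eq_pt_add`). Pleasant alternation means that the partial sums
of `G` are `0` or `1` and end at `1`, so `D` is a cycle, with coefficients in `{0, 1}` from `i`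
onwards and in `{-1, 0}` before `i`.

To get `NP = B` and `PN = A` it suffices that `1` lies in `NP` and in `PN`. The elements of degree
`0` of `M(X, Y) M(Y, X)` form the ideal `∑_m I(C_m) I(-C_m)`, where `C_m = G_m + σ⁻ᵐ(Y) - X`. Since
`Z` is lonely, a prime ideal lies over at most one index `j`, and it contains neither `I(C)` nor
`I(-C)` when `C` vanishes at `j`. So the ideal is the unit ideal as soon as for every `j` some `C_m`
vanishes at `j` (`IsLonely.eq_top_of_forall_mul_le`). For `NP` this is what the signs of the
coefficients of `D` provide; for `PN` one lets `m` tend to `∞` or `-∞`.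

The remaining assertions are Morita theory for the pairings `N × P → B` and `P × N → A`
(`GradedMoritaContext`). Writing `1 = ∑ xᵢ yᵢ` and `1 = ∑ yᵢ xᵢ` with homogeneous factors of opposite
degrees yields explicit inverses of `B → End_A(N)`, of `P → Hom_A(N, A)` and of
`X → Hom_B(P, Hom_A(N, X))`. These respect degrees, and they show that every homomorphism `N → X`
is a finite sum of homogeneous ones.
-/

noncomputable section

namespace LonelyCycles

/-! ### Graded Morita contexts -/

section MoritaContext

open MulOpposite

variable {k : Type w} [Field k] {A B : Type u} [Ring A] [Algebra k A] [Ring B] [Algebra k B]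

theorem RHom.apply_op_smul {N X : Type u} [AddCommGroup N] [Module B N] [Module Aᵐᵒᵖ N]
    [SMulCommClass B Aᵐᵒᵖ N] [AddCommGroup X] [Module Aᵐᵒᵖ X] (f : RHom A B N X) (a : A) (z : N) :
    f (op a • z) = op a • f z :=
  LinearMap.map_smul (show N →ₗ[Aᵐᵒᵖ] X from f) (op a) z

/-- A strict graded Morita context between the `ℤ`-graded algebras `A = ⊕ 𝒜 n` and `B = ⊕ ℬ n`:
graded bimodules `N` over `(B, A)` and `P` over `(A, B)` with associative, balanced pairings
`N × P → B` and `P × N → A` that are onto. Surjectivity is recorded in the form that `1` is a sum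
of products of homogeneous elements of opposite degrees. -/
structure GradedMoritaContext (𝒜 : ℤ → Submodule k A) (ℬ : ℤ → Submodule k B)
    (N P : Type u) [AddCommGroup N] [Module B N] [Module Aᵐᵒᵖ N]
    [AddCommGroup P] [Module A P] [Module Bᵐᵒᵖ P] where
  /-- the pairing `N × P → B` -/
  np : N →+ P →+ B
  /-- the pairing `P × N → A` -/
  pn : P →+ N →+ A
  np_smul_left : ∀ (b : B) (x : N) (y : P), np (b • x) y = b * np x y
  np_smul_right : ∀ (x : N) (b : B) (y : P), np x (op b • y) = np x y * b
  np_balanced : ∀ (x : N) (a : A) (y : P), np (op a • x) y = np x (a • y)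
  pn_smul_left : ∀ (a : A) (y : P) (x : N), pn (a • y) x = a * pn y x
  pn_smul_right : ∀ (y : P) (a : A) (x : N), pn y (op a • x) = pn y x * a
  pn_balanced : ∀ (y : P) (b : B) (x : N), pn (op b • y) x = pn y (b • x)
  np_smul : ∀ (x : N) (y : P) (x' : N), np x y • x' = op (pn y x') • x
  pn_smul : ∀ (y : P) (x : N) (y' : P), pn y x • y' = op (np x y') • y
  /-- the homogeneous elements of `N` -/
  degN : ℤ → AddSubgroup N
  /-- the homogeneous elements of `P` -/
  degP : ℤ → AddSubgroup P
  iSup_degN : ⨆ n, degN n = ⊤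
  iSup_degP : ⨆ n, degP n = ⊤
  smul_degN : ∀ m n, ∀ b ∈ ℬ m, ∀ x ∈ degN n, b • x ∈ degN (m + n)
  smul_degP : ∀ m n, ∀ a ∈ 𝒜 m, ∀ y ∈ degP n, a • y ∈ degP (m + n)
  np_mem : ∀ m n, ∀ x ∈ degN m, ∀ y ∈ degP n, np x y ∈ ℬ (m + n)
  pn_mem : ∀ m n, ∀ y ∈ degP m, ∀ x ∈ degN n, pn y x ∈ 𝒜 (m + n)
  one_mem_np : (1 : B) ∈ AddSubgroup.closure
    {b | ∃ m n, m + n = 0 ∧ ∃ x ∈ degN m, ∃ y ∈ degP n, np x y = b}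
  one_mem_pn : (1 : A) ∈ AddSubgroup.closure
    {a | ∃ m n, m + n = 0 ∧ ∃ y ∈ degP m, ∃ x ∈ degN n, pn y x = a}

namespace GradedMoritaContext

variable {𝒜 : ℤ → Submodule k A} {ℬ : ℤ → Submodule k B}
  {N P : Type u} [AddCommGroup N] [Module B N] [Module Aᵐᵒᵖ N]
  [AddCommGroup P] [Module A P] [Module Bᵐᵒᵖ P]

/-- The context with the roles of `A` and `B`, and of `N` and `P`, exchanged. -/
def swap (C : GradedMoritaContext 𝒜 ℬ N P) : GradedMoritaContext ℬ 𝒜 P N where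
  np := C.pn
  pn := C.np
  np_smul_left := C.pn_smul_left
  np_smul_right := C.pn_smul_right
  np_balanced := C.pn_balanced
  pn_smul_left := C.np_smul_left
  pn_smul_right := C.np_smul_right
  pn_balanced := C.np_balanced
  np_smul := C.pn_smul
  pn_smul := C.np_smul
  degN := C.degP
  degP := C.degN
  iSup_degN := C.iSup_degP
  iSup_degP := C.iSup_degN
  smul_degN := C.smul_degP
  smul_degP := C.smul_degN
  np_mem := C.pn_mem
  pn_mem := C.np_mem
  one_mem_np := C.one_mem_pn
  one_mem_pn := C.one_mem_np

variable (C : GradedMoritaContext 𝒜 ℬ N P)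

theorem exists_np_sum_eq_one : ∃ (ι : Type) (_ : Fintype ι) (x : ι → N) (y : ι → P),
    (∀ i, ∃ m n, m + n = 0 ∧ x i ∈ C.degN m ∧ y i ∈ C.degP n) ∧
      ∑ i, C.np (x i) (y i) = 1 := by
  have h := C.one_mem_np
  generalize (1 : B) = b at h ⊢
  induction h using AddSubgroup.closure_induction with
  | mem b hb =>
    obtain ⟨m, n, hmn, x, hx, y, hy, rfl⟩ := hb
    exact ⟨Unit, inferInstance, fun _ => x, fun _ => y, fun _ => ⟨m, n, hmn, hx, hy⟩, by simp⟩
  | zero => exact ⟨Empty, inferInstance, Empty.elim, Empty.elim, fun i => i.elim, by simp⟩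
  | add b c _ _ hb hc =>
    obtain ⟨ι, _, x, y, h, rfl⟩ := hb
    obtain ⟨κ, _, x', y', h', rfl⟩ := hc
    refine ⟨ι ⊕ κ, inferInstance, Sum.elim x x', Sum.elim y y', ?_, by simp⟩
    rintro (i | i)
    · exact h i
    · exact h' i
  | neg b _ hb =>
    obtain ⟨ι, _, x, y, h, rfl⟩ := hb
    refine ⟨ι, inferInstance, fun i => -x i, y, fun i => ?_, by simp⟩
    obtain ⟨m, n, hmn, hx, hy⟩ := h i
    exact ⟨m, n, hmn, neg_mem hx, hy⟩

theorem exists_pn_sum_eq_one : ∃ (ι : Type) (_ : Fintype ι) (y : ι → P) (x : ι → N),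
    (∀ i, ∃ m n, m + n = 0 ∧ y i ∈ C.degP m ∧ x i ∈ C.degN n) ∧
      ∑ i, C.pn (y i) (x i) = 1 :=
  C.swap.exists_np_sum_eq_one

/-! ### Endomorphisms and duals in a Morita context -/

theorem eq_zero_of_forall_pn_eq_zero {y : P} (h : ∀ x, C.pn y x = 0) : y = 0 := by
  obtain ⟨ι, _, x, z, -, hs⟩ := C.exists_np_sum_eq_one
  calc y = op (∑ i, C.np (x i) (z i)) • y := by rw [hs]; simp
    _ = ∑ i, C.pn y (x i) • z i := by
      simp [Finset.sum_smul, C.pn_smul]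
    _ = 0 := by simp [h]

/-- Left multiplication identifies `B` with `End_A(N)`: the inverse sends `f` to
`∑ f(xᵢ) yᵢ`, where `1 = ∑ xᵢ yᵢ` in `B`. -/
theorem bijective_toModuleEnd (C : GradedMoritaContext 𝒜 ℬ N P) [SMulCommClass B Aᵐᵒᵖ N] :
    Function.Bijective (Module.toModuleEnd Aᵐᵒᵖ N : B →+* Module.End Aᵐᵒᵖ N) := by
  obtain ⟨ι, _, x, y, -, hs⟩ := C.exists_np_sum_eq_one
  refine ⟨(injective_iff_map_eq_zero _).2 fun b hb => ?_, fun f =>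
    ⟨∑ i, C.np (f (x i)) (y i), LinearMap.ext fun z => ?_⟩⟩
  · have hb' : ∀ x : N, b • x = 0 := fun x => LinearMap.congr_fun hb x
    rw [← mul_one b, ← hs, Finset.mul_sum]
    simp [← C.np_smul_left, hb']
  · change (∑ i, C.np (f (x i)) (y i)) • z = f z
    calc (∑ i, C.np (f (x i)) (y i)) • z = f ((∑ i, C.np (x i) (y i)) • z) := by
          simp only [Finset.sum_smul, C.np_smul, map_sum, map_smul]
      _ = f z := by rw [hs, one_smul]

/-- Left multiplication identifies `P` with the dual `Hom_A(N, A)`. -/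
theorem existsUnique_pn (f : N →ₗ[Aᵐᵒᵖ] A) : ∃! y : P, ∀ x, f x = C.pn y x := by
  obtain ⟨ι, _, x, y, -, hs⟩ := C.exists_np_sum_eq_one
  refine ⟨∑ i, f (x i) • y i, fun z => ?_, fun y' hy' => ?_⟩
  · calc f z = f ((∑ i, C.np (x i) (y i)) • z) := by rw [hs, one_smul]
      _ = _ := by
        simp only [Finset.sum_smul, C.np_smul, map_sum, map_smul, AddMonoidHom.finsetSum_apply,
          C.pn_smul_left]
        rfl
  · refine sub_eq_zero.1 (C.eq_zero_of_forall_pn_eq_zero fun z => ?_)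
    rw [map_sub, AddMonoidHom.sub_apply, ← hy' z, sub_eq_zero]
    simp only [map_sum, AddMonoidHom.finsetSum_apply, C.pn_smul_left]
    calc f z = f ((∑ i, C.np (x i) (y i)) • z) := by rw [hs, one_smul]
      _ = _ := by
        simp only [Finset.sum_smul, C.np_smul, map_sum, map_smul]
        rfl

/-! ### The equivalence of module categories -/

variable [SMulCommClass B Aᵐᵒᵖ N] [SMulCommClass A Bᵐᵒᵖ P]

/-- The homomorphism `N → X`, `z ↦ x · (y z)`. -/
def evalHom {X : Type u} [AddCommGroup X] [Module Aᵐᵒᵖ X] (x : X) (y : P) : RHom A B N X :=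
  show N →ₗ[Aᵐᵒᵖ] X from
  { toFun := fun z => op (C.pn y z) • x
    map_add' := fun z z' => by rw [map_add, MulOpposite.op_add, add_smul]
    map_smul' := fun a z => by
      change op (C.pn y (op a.unop • z)) • x = a • op (C.pn y z) • x
      rw [C.pn_smul_right, op_mul, mul_smul]; rfl }

variable (X : Type u) [AddCommGroup X] [Module Aᵐᵒᵖ X]

/-- The unit `X → Hom_B(P, Hom_A(N, X))`, `x ↦ (y ↦ (z ↦ x · (y z)))`. -/
def unitHom : X →ₗ[Aᵐᵒᵖ] RHom B A P (RHom A B N X) where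
  toFun x := show P →ₗ[Bᵐᵒᵖ] RHom A B N X from
    { toFun := fun y => C.evalHom x y
      map_add' := fun y y' => RHom.ext fun z => by
        change op (C.pn (y + y') z) • x = op (C.pn y z) • x + op (C.pn y' z) • x
        rw [map_add, AddMonoidHom.add_apply, MulOpposite.op_add, add_smul]
      map_smul' := fun b y => RHom.ext fun z => by
        change op (C.pn (op b.unop • y) z) • x = op (C.pn y (b.unop • z)) • x
        rw [C.pn_balanced] }
  map_add' x x' := RHom.ext fun y => RHom.ext fun z => smul_add (op (C.pn y z)) x x'
  map_smul' a x := RHom.ext fun y => RHom.ext fun z => by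
    change op (C.pn y z) • op a.unop • x = op (C.pn (a.unop • y) z) • x
    rw [C.pn_smul_left, op_mul, mul_smul]

theorem unitHom_apply (x : X) (y : P) (z : N) : C.unitHom X x y z = op (C.pn y z) • x := rfl

/-- The unit is bijective: its inverse is `g ↦ ∑ g(yᵢ)(xᵢ)`, where `1 = ∑ yᵢ xᵢ` in `A`.
The elements `yᵢ` and `xᵢ` can be taken homogeneous of opposite degrees. -/
theorem exists_leftInverse_unitHom :
    ∃ (ι : Type) (_ : Fintype ι) (y : ι → P) (x : ι → N),
      (∀ i, ∃ m n, m + n = 0 ∧ y i ∈ C.degP m ∧ x i ∈ C.degN n) ∧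
      (∀ v : X, ∑ i, C.unitHom X v (y i) (x i) = v) ∧
      ∀ g : RHom B A P (RHom A B N X), C.unitHom X (∑ i, g (y i) (x i)) = g := by
  obtain ⟨ι, _, y, x, h, hs⟩ := C.exists_pn_sum_eq_one
  refine ⟨ι, inferInstance, y, x, h, fun v => ?_, fun g => RHom.ext fun y' => RHom.ext fun x' => ?_⟩
  · simp only [unitHom_apply]
    rw [← Finset.sum_smul, ← Finset.op_sum, hs, op_one, one_smul]
  · rw [unitHom_apply, Finset.smul_sum]
    have h1 : ∀ i, op (C.pn y' x') • g (y i) (x i) = g (C.pn (y i) (x i) • y') x' := fun i => by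
      rw [← RHom.apply_op_smul, ← C.np_smul, C.pn_smul, RHom.apply_op_smul, RHom.smul_apply]
    simp only [h1]
    have h2 : ∑ i, C.pn (y i) (x i) • y' = y' := by rw [← Finset.sum_smul, hs, one_smul]
    let ev : P →+ X := AddMonoidHom.mk' (fun y' => g y' x') fun a b =>
      congrArg (fun f : RHom A B N X => f x')
        (LinearMap.map_add (show P →ₗ[Bᵐᵒᵖ] RHom A B N X from g) a b)
    change ∑ i, ev (C.pn (y i) (x i) • y') = ev y'
    rw [← map_sum, h2]

theorem bijective_unitHom : Function.Bijective (C.unitHom X) := by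
  obtain ⟨ι, _, y, x, -, h1, h2⟩ := C.exists_leftInverse_unitHom X
  exact ⟨fun v v' h => by rw [← h1 v, ← h1 v', h], fun g => ⟨_, h2 g⟩⟩

/-- The isomorphism of right `A`-modules `X ≅ Hom_B(P, Hom_A(N, X))`. -/
def unitEquiv : X ≃ₗ[Aᵐᵒᵖ] RHom B A P (RHom A B N X) :=
  LinearEquiv.ofBijective (C.unitHom X) (C.bijective_unitHom X)

/-- The natural isomorphism from the identity to `Hom_B(P, Hom_A(N, -))`. -/
def unitIso : 𝟭 (ModuleCat.{u} Aᵐᵒᵖ) ≅ rHomFunctor A B N ⋙ rHomFunctor B A P :=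
  NatIso.ofComponents (fun X => (C.unitEquiv X).toModuleIso) fun f =>
    ModuleCat.hom_ext <| LinearMap.ext fun v => RHom.ext (A := B) (B := A) (N := P) fun y =>
      RHom.ext (A := A) (B := B) (N := N) fun x => (f.hom.map_smul (op (C.pn y x)) v).symm

/-- The equivalence `Hom_A(N, -)` from right `A`-modules to right `B`-modules, with inverse
`Hom_B(P, -)`. -/
def equivalence : ModuleCat.{u} Aᵐᵒᵖ ≌ ModuleCat.{u} Bᵐᵒᵖ :=
  CategoryTheory.Equivalence.mk (rHomFunctor A B N) (rHomFunctor B A P) C.unitIso C.swap.unitIso.symm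

open scoped ModuleCat.Algebra in
/-- The equivalence `Hom_A(N, -)` as a Morita equivalence over `k`. Its `k`-linearity uses that
`k` acts on `N` on both sides in the same way. -/
def moritaEquivalence
    (hk : ∀ (c : k) (x : N), op (algebraMap k A c) • x = algebraMap k B c • x) :
    MoritaEquivalence k Aᵐᵒᵖ Bᵐᵒᵖ where
  eqv := C.equivalence
  linear :=
    { map_smul := fun {V _} f c => ModuleCat.hom_ext <| LinearMap.ext fun g =>
      RHom.ext (A := A) (B := B) (N := N) fun x => by
        let g' : N →ₗ[Aᵐᵒᵖ] V := g
        change algebraMap k Aᵐᵒᵖ c • f.hom (g' x) = f.hom (g' (algebraMap k B c • x))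
        rw [← hk, LinearMap.map_smul, LinearMap.map_smul]
        rfl }

end GradedMoritaContext

end MoritaContext

/-! ### Internal gradings -/

section Grading

variable {M : Type u} [AddCommGroup M] {deg : ℤ → AddSubgroup M}

/-- The projection of an internally graded group to the component of degree `n`. -/
def componentHom (h : DirectSum.IsInternal deg) (n : ℤ) : M →+ M :=
  (deg n).subtype.comp <| (DFinsupp.evalAddMonoidHom n).comp
    (AddEquiv.ofBijective (DirectSum.coeAddMonoidHom deg) h).symm.toAddMonoidHom

theorem componentHom_of_mem (h : DirectSum.IsInternal deg) (n : ℤ) {m : ℤ} {x : M}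
    (hx : x ∈ deg m) : componentHom h n x = if m = n then x else 0 := by
  have e : (AddEquiv.ofBijective (DirectSum.coeAddMonoidHom deg) h).symm x
      = DirectSum.of (fun i => deg i) m ⟨x, hx⟩ := by
    rw [AddEquiv.symm_apply_eq]
    exact (DirectSum.coeAddMonoidHom_of deg m ⟨x, hx⟩).symm
  change ((AddEquiv.ofBijective (DirectSum.coeAddMonoidHom deg) h).symm x n : M) = _
  rw [e]
  split_ifs with hmn
  · subst hmn; rw [DirectSum.of_eq_same]
  · rw [DirectSum.of_eq_of_ne _ _ _ (Ne.symm hmn)]; rfl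

theorem mem_of_isInternal (h : DirectSum.IsInternal deg) {S : AddSubgroup M}
    (hS : ∀ n, deg n ≤ S) (x : M) : x ∈ S := by
  obtain ⟨f, rfl⟩ := h.2 x
  induction f using DirectSum.induction_on with
  | zero => rw [map_zero]; exact S.zero_mem
  | of i y => rw [DirectSum.coeAddMonoidHom_of]; exact hS i y.2
  | add f g hf hg => rw [map_add]; exact S.add_mem hf hg

end Grading

namespace GradedMoritaContext

open MulOpposite

variable {k : Type w} [Field k] {A B : Type u} [Ring A] [Algebra k A] [Ring B] [Algebra k B]
  {𝒜 : ℤ → Submodule k A} {ℬ : ℤ → Submodule k B} [GradedAlgebra 𝒜]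
  {N P : Type u} [AddCommGroup N] [Module B N] [Module Aᵐᵒᵖ N]
  [AddCommGroup P] [Module A P] [Module Bᵐᵒᵖ P]
  [SMulCommClass B Aᵐᵒᵖ N] [SMulCommClass A Bᵐᵒᵖ P]

/-! ### The equivalence of categories of graded modules -/

/-- The homomorphisms `N → X` of degree `n`. -/
def homDeg (C : GradedMoritaContext 𝒜 ℬ N P) (X : GrModuleCat 𝒜) (n : ℤ) :
    AddSubgroup (RHom A B N X.mod) where
  carrier := {f | RHom.HasDegree (fun m => (C.degN m : Set N)) X.deg n f}
  add_mem' hf hg m x hx := add_mem (hf m x hx) (hg m x hx)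
  zero_mem' _ _ _ := zero_mem _
  neg_mem' hf m x hx := neg_mem (hf m x hx)

theorem unitHom_mem_homDeg (C : GradedMoritaContext 𝒜 ℬ N P) (X : GrModuleCat 𝒜) {m n : ℤ}
    {v : X.mod} (hv : v ∈ X.deg m) {y : P} (hy : y ∈ C.degP n) :
    C.unitHom X.mod v y ∈ C.homDeg X (m + n) := fun l x hx => by
  rw [add_assoc]
  exact X.smul_mem _ _ _ hv _ (C.pn_mem _ _ _ hy _ hx)

/-- Every homomorphism `f : N → X` is a sum of homogeneous ones: with `1 = ∑ xᵢ yᵢ` in `B` one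
has `f = ∑ (z ↦ f(xᵢ) · (yᵢ z))`, and `f(xᵢ)` is a sum of homogeneous elements of `X`. -/
theorem isInternal_homDeg (C : GradedMoritaContext 𝒜 ℬ N P) (X : GrModuleCat 𝒜) :
    DirectSum.IsInternal (C.homDeg X) := by
  -- on an element of degree `m`, the component of degree `n` of a sum of homogeneous
  -- homomorphisms is the component of degree `n + m` of its value
  have key (F : DirectSum ℤ fun n => C.homDeg X n) (n m : ℤ) (x : N) (hx : x ∈ C.degN m) :
      componentHom X.isInternal (n + m) ((DirectSum.coeAddMonoidHom (C.homDeg X) F) x)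
        = (F n : RHom A B N X.mod) x := by
    induction F using DirectSum.induction_on with
    | zero => rw [map_zero]; exact map_zero _
    | of i y =>
      rw [DirectSum.coeAddMonoidHom_of, componentHom_of_mem _ _ (y.2 m x hx)]
      split_ifs with h
      · obtain rfl : i = n := add_right_cancel h
        rw [DirectSum.of_eq_same]
      · rw [DirectSum.of_eq_of_ne _ _ _ (by rintro rfl; exact h rfl)]; rfl
    | add F F' hF hF' =>
      rw [map_add, DirectSum.add_apply]
      exact (map_add (componentHom X.isInternal (n + m)) _ _).trans (congrArg₂ (· + ·) hF hF')
  refine ⟨(injective_iff_map_eq_zero _).2 fun F hF => ?_, ?_⟩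
  · ext n : 2
    refine RHom.ext fun x => ?_
    let ev : N →+ X.mod := (show N →ₗ[Aᵐᵒᵖ] X.mod from (F n : RHom A B N X.mod)).toAddMonoidHom
    have hle : ⨆ m, C.degN m ≤ ev.ker := iSup_le fun m x hx => by
      have h := key F n m x hx
      rw [hF] at h
      exact h.symm.trans (map_zero _)
    rw [C.iSup_degN] at hle
    exact hle (AddSubgroup.mem_top x)
  · rw [← AddMonoidHom.range_eq_top, eq_top_iff]
    intro f _
    obtain ⟨ι, _, x, y, hxy, hs⟩ := C.exists_np_sum_eq_one
    have hf : f = ∑ i, C.unitHom X.mod (f (x i)) (y i) := RHom.ext fun z => by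
      let ev : RHom A B N X.mod →+ X.mod := AddMonoidHom.mk' (fun f => f z) fun _ _ => rfl
      change _ = ev (∑ i, C.unitHom X.mod (f (x i)) (y i))
      rw [map_sum]
      let f' : N →ₗ[Aᵐᵒᵖ] X.mod := f
      calc f' z = f' ((∑ i, C.np (x i) (y i)) • z) := by rw [hs, one_smul]
        _ = ∑ i, op (C.pn (y i) z) • f' (x i) := by
          simp only [Finset.sum_smul, C.np_smul, map_sum, map_smul]
    rw [hf]
    refine AddSubgroup.sum_mem _ fun i _ => ?_
    obtain ⟨-, n, -, -, hy⟩ := hxy i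
    let g : X.mod →+ RHom A B N X.mod := AddMonoidHom.mk' (fun v => C.unitHom X.mod v (y i))
      fun v w => by rw [map_add]; rfl
    refine mem_of_isInternal (S := (DirectSum.coeAddMonoidHom (C.homDeg X)).range.comap g)
      X.isInternal (fun m v hv => ?_) (f (x i))
    exact ⟨DirectSum.of (fun n => C.homDeg X n) (m + n) ⟨_, C.unitHom_mem_homDeg X hv hy⟩,
      DirectSum.coeAddMonoidHom_of _ _ _⟩

variable [GradedAlgebra ℬ]

/-- The functor `Hom_A(N, -)` on graded modules. -/
def grFunctor (C : GradedMoritaContext 𝒜 ℬ N P) : GrModuleCat 𝒜 ⥤ GrModuleCat ℬ where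
  obj X :=
    { mod := (rHomFunctor A B N).obj X.mod
      deg := C.homDeg X
      isInternal := C.isInternal_homDeg X
      smul_mem := fun m n f hf b hb l x hx => by
        have h := hf (n + l) _ (C.smul_degN n l b hb x hx)
        rw [← add_assoc] at h
        exact h }
  map φ :=
    { hom := (rHomFunctor A B N).map φ.hom
      map_deg := fun n _ hf m x hx => φ.map_deg (n + m) _ (hf m x hx) }
  map_id _ := rfl
  map_comp _ _ := rfl

/-- The unit of the equivalence preserves degrees, as does its inverse. -/
def grUnitIso (C : GradedMoritaContext 𝒜 ℬ N P) :
    𝟭 (GrModuleCat 𝒜) ≅ C.grFunctor ⋙ C.swap.grFunctor :=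
  NatIso.ofComponents (fun X =>
    { hom :=
        { hom := C.unitIso.hom.app X.mod
          map_deg := fun _ _ hv _ _ hy => C.unitHom_mem_homDeg X hv hy }
      inv :=
        { hom := C.unitIso.inv.app X.mod
          map_deg := fun n (g : RHom B A P (RHom A B N X.mod)) hg => by
            obtain ⟨ι, _, y, x, hyx, -, h⟩ := C.exists_leftInverse_unitHom X.mod
            have e : (C.unitEquiv X.mod).symm g = ∑ i, g (y i) (x i) :=
              (LinearEquiv.symm_apply_eq _).2 (h g).symm
            change (C.unitEquiv X.mod).symm g ∈ _
            rw [e]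
            refine AddSubgroup.sum_mem _ fun i _ => ?_
            obtain ⟨a, b, hab, hy, hx⟩ := hyx i
            have := hg a (y i) hy b (x i) hx
            rwa [add_assoc, hab, add_zero] at this }
      hom_inv_id := GrModuleCat.Hom.ext (C.unitIso.hom_inv_id_app X.mod)
      inv_hom_id := GrModuleCat.Hom.ext (C.unitIso.inv_hom_id_app X.mod) })
    fun {X Y} f => GrModuleCat.Hom.ext (C.unitIso.hom.naturality f.hom)

/-- The equivalence of the categories of graded modules. -/
def grEquivalence (C : GradedMoritaContext 𝒜 ℬ N P) : GrModuleCat 𝒜 ≌ GrModuleCat ℬ :=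
  CategoryTheory.Equivalence.mk C.grFunctor C.swap.grFunctor C.grUnitIso C.swap.grUnitIso.symm

/-- The graded Morita equivalence given by a graded Morita context. -/
def gradedMoritaEquivalence (C : GradedMoritaContext 𝒜 ℬ N P)
    (hk : ∀ (c : k) (x : N), op (algebraMap k A c) • x = algebraMap k B c • x) :
    GradedMoritaEquivalence 𝒜 ℬ where
  morita := C.moritaEquivalence hk
  graded := C.grEquivalence
  restricts := Iso.refl (C.grFunctor ⋙ GrModuleCat.forget ℬ)

theorem gradedMoritaEquivalence_isImplementedBy (C : GradedMoritaContext 𝒜 ℬ N P)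
    (hk : ∀ (c : k) (x : N), op (algebraMap k A c) • x = algebraMap k B c • x) :
    (C.gradedMoritaEquivalence hk).IsImplementedBy N P (fun n => (C.degN n : Set N)) :=
  ⟨⟨Iso.refl (rHomFunctor A B N), fun _ _ _ => Iff.rfl⟩, ⟨Iso.refl (rHomFunctor B A P)⟩⟩

end GradedMoritaContext

/-! ### Partial sums of cycles -/

namespace Cycle

theorem partialSum_unique {G : Cycle} {f : ℤ → Cycle} (h0 : f 0 = 0)
    (h : ∀ n, f (n + 1) = f n + shift (-n) G) (n : ℤ) : G.partialSum n = f n := by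
  induction n using Int.induction_on with
  | zero => rw [partialSum_zero, h0]
  | succ n ih => rw [partialSum_succ, h, ih]
  | pred n ih =>
    have h1 := partialSum_succ G (-(n : ℤ) - 1)
    have h2 := h (-(n : ℤ) - 1)
    rw [sub_add_cancel] at h1 h2
    exact add_right_cancel (h1.symm.trans (ih.trans h2))

theorem partialSum_pt_apply (i n l : ℤ) :
    (pt i).partialSum n l = (if i ≤ l then 1 else 0) - (if i + n ≤ l then 1 else 0) := by
  induction n using Int.induction_on with
  | zero => simp [partialSum_zero]
  | succ n ih =>
    rw [partialSum_succ, Finsupp.add_apply, ih, shift_apply, pt, Finsupp.single_apply]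
    split_ifs <;> omega
  | pred n ih =>
    have h := DFunLike.congr_fun (partialSum_succ (pt i) (-(n : ℤ) - 1)) l
    rw [sub_add_cancel, ih, Finsupp.add_apply, shift_apply, pt, Finsupp.single_apply] at h
    rw [pt]
    split_ifs at h ⊢ <;> omega

theorem partialSum_add_shift_sub (G D : Cycle) (n : ℤ) :
    (G + shift (-1) D - D).partialSum n = G.partialSum n + shift (-n) D - D := by
  refine partialSum_unique (f := fun n => G.partialSum n + shift (-n) D - D) ?_ (fun n => ?_) n
  · ext l; simp [partialSum_zero]
  · ext l
    simp only [partialSum_succ, Finsupp.add_apply, Finsupp.sub_apply, shift_apply]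
    rw [show -(n + 1) + l = -1 + (-n + l) by ring]
    ring

/-- The partial sums of the coefficients of a pleasantly alternating cycle are `0` or `1`, and
the total is `1`, so `G` differs from `Zᵢ` by a coboundary `σ⁻¹(D) - D`, where the coefficient of
`D` at `l` is `[i ≤ l] - ∑_{j ≤ l} G_j`. -/
theorem IsPleasantlyAlternating.exists_eq_pt_add {G : Cycle} (hG : G.IsPleasantlyAlternating)
    (i : ℤ) : ∃ D : Cycle, G = pt i + shift (-1) D - D ∧
      (∀ l, i ≤ l → D l = 0 ∨ D l = 1) ∧ ∀ l, l < i → D l = 0 ∨ D l = -1 := by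
  obtain ⟨m, n, hmn, hsupp, hm, hn, hval, halt⟩ := hG
  set S : ℤ → ℤ := fun l => ∑ j ∈ Finset.Icc m l, G j with hS
  have hS0 : ∀ l, l < m → S l = 0 := fun l hl => by
    rw [hS]; simp only; rw [Finset.Icc_eq_empty (by omega), Finset.sum_empty]
  have hSm : S m = 1 := by simp [hS, hm]
  have hstep : ∀ l, S l = S (l - 1) + G l := fun l => by
    rcases lt_or_ge l m with h | h
    · rw [hS0 l h, hS0 _ (by omega)]
      by_contra hne
      have := hsupp l (by omega)
      omega
    · have : Finset.Icc m l = insert l (Finset.Icc m (l - 1)) := by ext; simp; omega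
      simp only [hS]
      rw [this, Finset.sum_insert (by simp), add_comm]
  -- after the last nonzero coefficient at or before `l`, the partial sum is `1` or `0`
  -- according to the sign of that coefficient
  have hinv : ∀ l, m ≤ l → ∃ j ≤ l, (∀ e, j < e → e ≤ l → G e = 0) ∧
      (G j = 1 ∧ S l = 1 ∨ G j = -1 ∧ S l = 0) := by
    intro l hl
    induction l, hl using Int.leInduction with
    | base => exact ⟨m, le_rfl, fun e _ _ => by omega, Or.inl ⟨hm, hSm⟩⟩
    | succ l hl ih =>
      obtain ⟨j, hj, hz, hc⟩ := ih
      have hs := hstep (l + 1)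
      rw [add_sub_cancel_right] at hs
      by_cases h0 : G (l + 1) = 0
      · refine ⟨j, by omega, fun e h1 h2 => ?_, by rwa [hs, h0, add_zero]⟩
        rcases eq_or_lt_of_le h2 with rfl | h2
        · exact h0
        · exact hz e h1 (by omega)
      · have := halt j (l + 1) (by omega) (by omega) h0 fun e h1 h2 => hz e h1 (by omega)
        exact ⟨l + 1, le_rfl, fun e _ _ => by omega, by omega⟩
  have hS01 : ∀ l, S l = 0 ∨ S l = 1 := fun l => by
    rcases lt_or_ge l m with h | h
    · exact Or.inl (hS0 l h)
    · obtain ⟨j, -, -, hc⟩ := hinv l h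
      omega
  have hSn : ∀ l, n ≤ l → S l = 1 := by
    intro l hl
    induction l, hl using Int.leInduction with
    | base =>
      obtain ⟨j, hj, hz, hc⟩ := hinv n hmn
      rcases eq_or_lt_of_le hj with rfl | hj
      · omega
      · have := hz n hj le_rfl
        omega
    | succ l hl ih =>
      have hs := hstep (l + 1)
      rw [add_sub_cancel_right] at hs
      by_cases h0 : G (l + 1) = 0
      · omega
      · have := hsupp _ h0
        omega
  let D : Cycle := Finsupp.onFinset (Finset.Icc (min m i) (max n i))
    (fun l => (if i ≤ l then 1 else 0) - S l) fun l hl => by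
      rw [Finset.mem_Icc]
      by_contra hcon
      refine hl ?_
      rcases lt_or_ge l (min m i) with h | h
      · rw [hS0 l (by omega), if_neg (by omega), sub_zero]
      · rw [hSn l (by omega), if_pos (by omega), sub_self]
  have hD : ∀ l, D l = (if i ≤ l then 1 else 0) - S l := fun l => rfl
  refine ⟨D, ?_, fun l hl => ?_, fun l hl => ?_⟩
  · ext l
    have hs := hstep l
    rw [Finsupp.sub_apply, Finsupp.add_apply, shift_apply, hD, hD, pt, Finsupp.single_apply,
      show -1 + l = l - 1 by ring]
    split_ifs <;> omega
  · have := hS01 l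
    rw [hD, if_pos hl]; omega
  · have := hS01 l
    rw [hD, if_neg (by omega)]; omega

end Cycle

/-! ### The ideals of cycles on a lonely orbit -/

variable {k : Type w} {R : Type u} [Field k] [CommRing R] [Algebra k R]

theorem map_twoSidedIdeal (σ : R ≃ₐ[k] R) (H J : Ideal R) (C : Cycle) (m : ℤ) :
    (twoSidedIdeal σ H J C).map (σ ^ m : R ≃ₐ[k] R)
      = twoSidedIdeal σ H J (Cycle.shift (-m) C) := by
  rw [twoSidedIdeal, Ideal.map_mul, map_cycleIdeal, map_cycleIdeal, twoSidedIdeal]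
  congr 2 <;> ext l <;> simp

/-- If `p` contains `H[D]`, then it contains one of the factors `σ^l(H)`, which means that
`σ^l` maps the point `p` into `V(H) ⊆ Z`. -/
theorem exists_specAut_mem_of_cycleIdeal_le {σ : R ≃ₐ[k] R} {Z : Set (PrimeSpectrum R)}
    {H : Ideal R} (hH : PrimeSpectrum.zeroLocus (H : Set R) ⊆ Z) {D : Cycle}
    {p : PrimeSpectrum R} (h : cycleIdeal σ H D ≤ p.asIdeal) :
    ∃ l, D l ≠ 0 ∧ specAut σ l p ∈ Z := by
  obtain ⟨l, hl, hle⟩ := (Ideal.IsPrime.prod_le p.2).1 h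
  refine ⟨l, Finsupp.mem_support_iff.1 hl, hH ?_⟩
  rw [PrimeSpectrum.mem_zeroLocus]
  intro x hx
  exact Ideal.IsPrime.le_of_pow_le hle (Ideal.mem_map_of_mem _ hx)

theorem exists_specAut_mem_of_twoSidedIdeal_le {σ : R ≃ₐ[k] R} {Z : Set (PrimeSpectrum R)}
    {H J : Ideal R} (hH : PrimeSpectrum.zeroLocus (H : Set R) ⊆ Z)
    (hJ : PrimeSpectrum.zeroLocus (J : Set R) ⊆ Z) {C : Cycle}
    {p : PrimeSpectrum R} (h : twoSidedIdeal σ H J C ≤ p.asIdeal) :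
    ∃ l, C l ≠ 0 ∧ specAut σ l p ∈ Z := by
  rcases (Ideal.IsPrime.mul_le p.2).1 h with h | h
  · obtain ⟨l, hl, hp⟩ := exists_specAut_mem_of_cycleIdeal_le hH h
    exact ⟨l, fun h0 => hl (by simp [h0]), hp⟩
  · obtain ⟨l, hl, hp⟩ := exists_specAut_mem_of_cycleIdeal_le hJ h
    exact ⟨l, fun h0 => hl (by simp [h0]), hp⟩

/-- A point of `Spec R` lies in at most one translate of a lonely set. -/
theorem IsLonely.eq_of_specAut_mem {σ : R ≃ₐ[k] R} {Z : Set (PrimeSpectrum R)}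
    (hZ : IsLonely σ Z) {p : PrimeSpectrum R} {j l : ℤ} (hj : specAut σ j p ∈ Z)
    (hl : specAut σ l p ∈ Z) : j = l := by
  by_contra hne
  have h : specAut σ l p ∈ Z ∩ specAut σ (l - j) '' Z := by
    refine ⟨hl, _, hj, PrimeSpectrum.ext (Ideal.ext fun x => ?_)⟩
    change (σ ^ j : R ≃ₐ[k] R) ((σ ^ (l - j) : R ≃ₐ[k] R) x) ∈ p.asIdeal ↔
      (σ ^ l : R ≃ₐ[k] R) x ∈ p.asIdeal
    rw [← AlgEquiv.mul_apply, ← zpow_add, add_sub_cancel]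
  rw [hZ (l - j) (by omega)] at h
  exact h

/-- If at each index one of the cycles `C m` vanishes, then the products `I(C m) I(-C m)` have no
common prime: a prime lies in only one translate of `Z`, hence over only one index. -/
theorem IsLonely.eq_top_of_forall_mul_le {σ : R ≃ₐ[k] R} {Z : Set (PrimeSpectrum R)}
    (hZ : IsLonely σ Z) {H J : Ideal R} (hH : PrimeSpectrum.zeroLocus (H : Set R) ⊆ Z)
    (hJ : PrimeSpectrum.zeroLocus (J : Set R) ⊆ Z) {C : ℤ → Cycle} (hC : ∀ j, ∃ m, C m j = 0)
    {K : Ideal R} (hK : ∀ m, twoSidedIdeal σ H J (C m) * twoSidedIdeal σ H J (-C m) ≤ K) :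
    K = ⊤ := by
  by_contra hne
  obtain ⟨M, hM, hKM⟩ := Ideal.exists_le_maximal K hne
  let p : PrimeSpectrum R := ⟨M, hM.isPrime⟩
  have hp : ∃ j, ∀ l, specAut σ l p ∈ Z → l = j := by
    by_cases h : ∃ j, specAut σ j p ∈ Z
    · exact ⟨h.choose, fun l hl => hZ.eq_of_specAut_mem hl h.choose_spec⟩
    · exact ⟨0, fun l hl => absurd ⟨l, hl⟩ h⟩
  obtain ⟨j, hj⟩ := hp
  obtain ⟨m, hm⟩ := hC j
  rcases (Ideal.IsPrime.mul_le p.2).1 ((hK m).trans hKM) with h | h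
  · obtain ⟨l, hl, hlp⟩ := exists_specAut_mem_of_twoSidedIdeal_le hH hJ h
    exact hl (by rw [hj l hlp, hm])
  · obtain ⟨l, hl, hlp⟩ := exists_specAut_mem_of_twoSidedIdeal_le hH hJ h
    exact hl (by rw [hj l hlp, Finsupp.neg_apply, hm, neg_zero])

/-- The spectrum of a domain is not lonely, because the zero ideal is fixed by `σ`. -/
theorem IsLonely.ne_bot [IsDomain R] {σ : R ≃ₐ[k] R} {Z : Set (PrimeSpectrum R)}
    (hZ : IsLonely σ Z) {H : Ideal R} (hH : PrimeSpectrum.zeroLocus (H : Set R) ⊆ Z) :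
    H ≠ ⊥ := by
  rintro rfl
  have hmem : ∀ p : PrimeSpectrum R, p ∈ Z := fun p => hH (by simp)
  let p : PrimeSpectrum R := ⟨⊥, Ideal.isPrime_bot⟩
  exact absurd (hZ.eq_of_specAut_mem (hmem (specAut σ 0 p)) (hmem (specAut σ 1 p))) (by decide)

/-- A nonzero element of `I(D)`, which is the component of degree `0` of `P`, embeds `N` into `A`
by left multiplication. -/
theorem twoSidedIdeal_ne_bot [IsDomain R] (σ : R ≃ₐ[k] R) {H J : Ideal R} (hH : H ≠ ⊥)
    (hJ : J ≠ ⊥) (C : Cycle) : twoSidedIdeal σ H J C ≠ ⊥ := by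
  have key (I : Ideal R) (hI : I ≠ ⊥) (D : Cycle) : cycleIdeal σ I D ≠ 0 :=
    Finset.prod_ne_zero_iff.2 fun l _ => pow_ne_zero _ fun h => hI
      ((Ideal.map_eq_bot_iff_of_injective (f := (σ ^ l : R ≃ₐ[k] R))
        (σ ^ l : R ≃ₐ[k] R).injective).1 h)
  exact mul_ne_zero (key H hH _) (key J hJ _)

/-! ### Graded subspaces of the skew Laurent ring -/

namespace SkewLaurent

variable {σ : R ≃ₐ[k] R}

theorem monomial_zero (n : ℤ) : monomial σ n 0 = 0 :=
  ext fun m => by rw [coeff_monomial, map_zero, ite_self]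

theorem monomial_add (n : ℤ) (r s : R) :
    monomial σ n (r + s) = monomial σ n r + monomial σ n s :=
  ext fun m => by simp only [map_add, coeff_monomial]; split_ifs <;> simp

theorem monomial_mem_homogeneous (n : ℤ) (r : R) : monomial σ n r ∈ homogeneous σ n :=
  fun m hm => by rw [coeff_monomial, if_neg hm.symm]

theorem monomial_mem_ofIdeals {K : ℤ → Ideal R} {n : ℤ} {r : R} (hr : r ∈ K n) :
    monomial σ n r ∈ ofIdeals σ K := fun m => by
  rw [coeff_monomial]
  split_ifs with h
  · exact h ▸ hr
  · exact Ideal.zero_mem _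

theorem mul_mem_homogeneous {m n : ℤ} {x y : SkewLaurent σ} (hx : x ∈ homogeneous σ m)
    (hy : y ∈ homogeneous σ n) : x * y ∈ homogeneous σ (m + n) := fun l hl => by
  have h := coeff_mul_mem (fun l => if l = m + n then ⊤ else ⊥) x y (fun a b => ?_) l
  · rw [if_neg hl] at h; exact h
  · by_cases ha : a = m
    · by_cases hb : b = n
      · rw [if_pos (by rw [ha, hb])]; trivial
      · rw [hy b hb, map_zero, mul_zero]; exact Ideal.zero_mem _
    · rw [hx a ha, zero_mul]; exact Ideal.zero_mem _

theorem mem_of_forall_monomial_mem {S : AddSubgroup (SkewLaurent σ)} {x : SkewLaurent σ}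
    (h : ∀ n, monomial σ n (coeff σ n x) ∈ S) : x ∈ S := by
  classical
  have e : x = ∑ a ∈ SkewMonoidAlgebra.support (k := R) (G := Multiplicative ℤ) x,
      monomial σ a.toAdd (coeff σ a.toAdd x) := by
    refine ext fun n => ?_
    rw [map_sum]
    simp only [coeff_monomial]
    rw [Finset.sum_eq_single (Multiplicative.ofAdd n)]
    · exact (if_pos rfl).symm
    · intro b _ hb
      exact if_neg fun h => hb (by rw [← h]; rfl)
    · intro hn
      exact (if_pos rfl).trans (SkewMonoidAlgebra.notMem_support_iff.1 hn)
  rw [e]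
  exact AddSubgroup.sum_mem _ fun a _ => h _

end SkewLaurent

/-- Products of homogeneous elements of opposite degrees, the first from `V` and the second
from `W`. -/
def zeroDegreeProducts {σ : R ≃ₐ[k] R} (V W : Submodule k (SkewLaurent σ)) :
    Set (SkewLaurent σ) :=
  {u | ∃ m n, m + n = 0 ∧ ∃ x ∈ V, x ∈ SkewLaurent.homogeneous σ m ∧
    ∃ y ∈ W, y ∈ SkewLaurent.homogeneous σ n ∧ x * y = u}

/-! ### The bimodules `⊕ I(G_n + σ⁻ⁿ(Y) - X) tⁿ` -/

/-- The graded subspace `⊕ I(G_n + σ⁻ⁿ(Y) - X) tⁿ` of the skew Laurent ring. The ring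
`B(G, H, J)` is the case `X = Y = 0`, and `B(G + σ⁻¹(D) - D, H, J)` the case `X = Y = D`; the
mixed cases are bimodules over these rings. -/
def homSpace (σ : R ≃ₐ[k] R) (H J : Ideal R) (G X Y : Cycle) : Submodule k (SkewLaurent σ) :=
  SkewLaurent.ofIdeals σ fun n =>
    twoSidedIdeal σ H J (G.partialSum n + Cycle.shift (-n) Y - X)

section homSpace

variable {σ : R ≃ₐ[k] R} {H J : Ideal R} {G : Cycle}

theorem mul_mem_homSpace {X Y W : Cycle} {x y : SkewLaurent σ}
    (hx : x ∈ homSpace σ H J G X Y) (hy : y ∈ homSpace σ H J G Y W) :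
    x * y ∈ homSpace σ H J G X W := by
  refine SkewLaurent.coeff_mul_mem _ x y fun m n => ?_
  have h := twoSidedIdeal_mul_le σ H J _ _ m
    (Ideal.mul_mem_mul (hx m) (Ideal.mem_map_of_mem (σ ^ m : R ≃ₐ[k] R) (hy n)))
  convert h using 2
  rw [Cycle.partialSum_add]
  ext l
  simp only [Finsupp.add_apply, Finsupp.sub_apply, Cycle.shift_apply]
  rw [show -(m + n) + l = -n + (-m + l) by ring]
  ring

theorem toSubmodule_ringB (σ : R ≃ₐ[k] R) (H J : Ideal R) (G : Cycle) :
    Subalgebra.toSubmodule (ringB σ G H J) = homSpace σ H J G 0 0 := by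
  have h : ∀ n, G.partialSum n = G.partialSum n + Cycle.shift (-n) 0 - 0 := fun n => by
    ext l; simp
  change SkewLaurent.ofIdeals σ _ = _
  simp only [homSpace, ← h]

theorem toSubmodule_ringB_add_shift_sub (σ : R ≃ₐ[k] R) (H J : Ideal R) (G D : Cycle) :
    Subalgebra.toSubmodule (ringB σ (G + Cycle.shift (-1) D - D) H J)
      = homSpace σ H J G D D := by
  change SkewLaurent.ofIdeals σ _ = _
  simp only [homSpace, Cycle.partialSum_add_shift_sub]

/-- The degree-zero parts of the products `V_m W_{-m}`, for `V = homSpace X Y` and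
`W = homSpace Y X`, form the ideal `∑ I(C_m) I(-C_m)` with `C_m = G_m + σ⁻ᵐ(Y) - X`, which is
the unit ideal if every index is missed by some `C_m`. -/
theorem one_mem_closure_zeroDegreeProducts {Z : Set (PrimeSpectrum R)} (hZ : IsLonely σ Z)
    (hH : PrimeSpectrum.zeroLocus (H : Set R) ⊆ Z) (hJ : PrimeSpectrum.zeroLocus (J : Set R) ⊆ Z)
    {X Y : Cycle} (hXY : ∀ j, ∃ m, (G.partialSum m + Cycle.shift (-m) Y - X) j = 0) :
    (1 : SkewLaurent σ) ∈ AddSubgroup.closure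
      (zeroDegreeProducts (homSpace σ H J G X Y) (homSpace σ H J G Y X)) := by
  set T := AddSubgroup.closure
    (zeroDegreeProducts (homSpace σ H J G X Y) (homSpace σ H J G Y X)) with hT
  let K : Ideal R :=
    { carrier := {r | SkewLaurent.monomial σ 0 r ∈ T}
      add_mem' := fun {a b} ha hb => by
        change SkewLaurent.monomial σ 0 (a + b) ∈ T
        rw [SkewLaurent.monomial_add]
        exact add_mem ha hb
      zero_mem' := by
        change SkewLaurent.monomial σ 0 0 ∈ T
        rw [SkewLaurent.monomial_zero]
        exact zero_mem _
      smul_mem' := fun r s hs => by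
        have hle : T ≤ T.comap (AddMonoidHom.mulLeft (SkewLaurent.monomial σ 0 r)) := by
          rw [hT, AddSubgroup.closure_le]
          rintro _ ⟨m, n, hmn, x, hx, hxm, y, hy, hyn, rfl⟩
          refine AddSubgroup.subset_closure ⟨m, n, hmn, SkewLaurent.monomial σ 0 r * x, ?_, ?_,
            y, hy, hyn, mul_assoc _ _ _⟩
          · refine mul_mem_homSpace (Y := X) (SkewLaurent.monomial_mem_ofIdeals ?_) hx
            have h0 : G.partialSum 0 + Cycle.shift (-0) X - X = 0 := by
              ext l; simp [Cycle.partialSum_zero]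
            rw [h0, twoSidedIdeal_zero]
            trivial
          · have := SkewLaurent.mul_mem_homogeneous
              (SkewLaurent.monomial_mem_homogeneous (σ := σ) 0 r) hxm
            rwa [zero_add] at this
        have h := hle hs
        change SkewLaurent.monomial σ 0 r * SkewLaurent.monomial σ 0 s ∈ T at h
        rw [SkewLaurent.monomial_mul_monomial] at h
        exact h }
  have hK : K = ⊤ := by
    refine hZ.eq_top_of_forall_mul_le hH hJ hXY fun m => Ideal.mul_le.2 fun a ha b hb => ?_
    refine AddSubgroup.subset_closure ⟨m, -m, add_neg_cancel m, SkewLaurent.monomial σ m a,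
      SkewLaurent.monomial_mem_ofIdeals ha, SkewLaurent.monomial_mem_homogeneous _ _,
      SkewLaurent.monomial σ (-m) ((σ ^ (-m) : R ≃ₐ[k] R) b),
      SkewLaurent.monomial_mem_ofIdeals ?_, SkewLaurent.monomial_mem_homogeneous _ _, ?_⟩
    · have h := Ideal.mem_map_of_mem (σ ^ (-m) : R ≃ₐ[k] R) hb
      rw [map_twoSidedIdeal] at h
      convert h using 2
      have h0 := Cycle.partialSum_add G (-m) m
      rw [neg_add_cancel, Cycle.partialSum_zero] at h0
      ext l
      have h1 := DFunLike.congr_fun h0 l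
      simp only [Finsupp.add_apply, Finsupp.sub_apply, Finsupp.neg_apply, Cycle.shift_apply,
        Finsupp.zero_apply] at h1 ⊢
      rw [show -m + (-(-m) + l) = l by ring]
      linarith
    · rw [SkewLaurent.monomial_mul_monomial, ← AlgEquiv.mul_apply, ← zpow_add, add_neg_cancel,
        zpow_zero, AlgEquiv.one_apply]
  have h1 : (1 : R) ∈ K := hK ▸ trivial
  exact h1

/-- With `1 ∈ V W`, where `V = homSpace X Y` and `W = homSpace Y X`, any `b` in the ring
`homSpace X X` is `b · 1 ∈ (b V) W ⊆ V W`. -/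
theorem homSpace_mul_homSpace {X Y : Cycle} (h : (1 : SkewLaurent σ) ∈ AddSubgroup.closure
      (zeroDegreeProducts (homSpace σ H J G X Y) (homSpace σ H J G Y X))) :
    homSpace σ H J G X Y * homSpace σ H J G Y X = homSpace σ H J G X X := by
  refine le_antisymm (Submodule.mul_le.2 fun x hx y hy => mul_mem_homSpace hx hy) fun b hb => ?_
  have h1 : (1 : SkewLaurent σ) ∈ homSpace σ H J G X Y * homSpace σ H J G Y X := by
    refine (AddSubgroup.closure_le
      (homSpace σ H J G X Y * homSpace σ H J G Y X).toAddSubgroup).2 ?_ h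
    rintro _ ⟨m, n, -, x, hx, -, y, hy, -, rfl⟩
    exact Submodule.mul_mem_mul hx hy
  have h2 := Submodule.mul_mem_mul hb h1
  rw [mul_one, ← mul_assoc] at h2
  exact mul_le_mul'
    (Submodule.mul_le.2 fun x hx y hy => mul_mem_homSpace hx hy) le_rfl h2

end homSpace

/-! ### The Morita context in the skew Laurent ring -/

section Context

variable {σ : R ≃ₐ[k] R} {H J : Ideal R} {G G' : Cycle}

theorem iSup_homogeneous_eq_top {A B : Subalgebra k (SkewLaurent σ)} (N : SubBimodule B A)
    {K : ℤ → Ideal R} (hN : N.space = SkewLaurent.ofIdeals σ K) :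
    ⨆ n, (SkewLaurent.homogeneous σ n).toAddSubgroup.comap N.incl = ⊤ := by
  refine eq_top_iff.2 fun x _ => ?_
  have hx : x.1 ∈ AddSubgroup.map N.incl
      (⨆ n, (SkewLaurent.homogeneous σ n).toAddSubgroup.comap N.incl) := by
    refine SkewLaurent.mem_of_forall_monomial_mem fun n => ?_
    have hm : SkewLaurent.monomial σ n (SkewLaurent.coeff σ n x.1) ∈ N.space := by
      have hx : x.1 ∈ SkewLaurent.ofIdeals σ K := hN.le x.2
      exact hN.ge (SkewLaurent.monomial_mem_ofIdeals (hx n))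
    exact ⟨⟨_, hm⟩, AddSubgroup.mem_iSup_of_mem n
      (SkewLaurent.monomial_mem_homogeneous (σ := σ) n _), rfl⟩
  obtain ⟨y, hy, hyx⟩ := hx
  have e : y = x := Subtype.ext hyx
  exact e ▸ hy

/-- The pairing of two subspaces given by multiplication, with values in a subalgebra. -/
def mulPairing {A B : Subalgebra k (SkewLaurent σ)} (N : SubBimodule B A) (P : SubBimodule A B)
    (h : ∀ x ∈ N.space, ∀ y ∈ P.space, x * y ∈ B) : N.Elt →+ P.Elt →+ B :=
  AddMonoidHom.mk' (fun x => AddMonoidHom.mk' (fun y => ⟨x.1 * y.1, h _ x.2 _ y.2⟩)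
    fun y y' => Subtype.ext (mul_add x.1 y.1 y'.1))
    fun x x' => AddMonoidHom.ext fun y => Subtype.ext (add_mul x.1 x'.1 y.1)

theorem one_mem_closure_mulPairing {A B : Subalgebra k (SkewLaurent σ)} (N : SubBimodule B A)
    (P : SubBimodule A B) (h : ∀ x ∈ N.space, ∀ y ∈ P.space, x * y ∈ B)
    (h1 : (1 : SkewLaurent σ) ∈ AddSubgroup.closure (zeroDegreeProducts N.space P.space)) :
    (1 : B) ∈ AddSubgroup.closure {b | ∃ m n, m + n = 0 ∧
      ∃ x ∈ (SkewLaurent.homogeneous σ m).toAddSubgroup.comap N.incl,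
      ∃ y ∈ (SkewLaurent.homogeneous σ n).toAddSubgroup.comap P.incl,
        mulPairing N P h x y = b} := by
  have hle : AddSubgroup.closure (zeroDegreeProducts N.space P.space) ≤
      AddSubgroup.map (B.val : B →+ SkewLaurent σ) (AddSubgroup.closure {b | ∃ m n, m + n = 0 ∧
        ∃ x ∈ (SkewLaurent.homogeneous σ m).toAddSubgroup.comap N.incl,
        ∃ y ∈ (SkewLaurent.homogeneous σ n).toAddSubgroup.comap P.incl,
          mulPairing N P h x y = b}) := by
    rw [AddSubgroup.closure_le]
    rintro _ ⟨m, n, hmn, x, hx, hxm, y, hy, hyn, rfl⟩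
    exact ⟨_, AddSubgroup.subset_closure ⟨m, n, hmn, ⟨x, hx⟩, hxm, ⟨y, hy⟩, hyn, rfl⟩, rfl⟩
  obtain ⟨b, hb, hb1⟩ := hle h1
  have e : b = 1 := Subtype.ext hb1
  exact e ▸ hb

/-- The Morita context between the rings `B(G', H, J)` and `B(G, H, J)` given by multiplication
of graded sub-bimodules of the skew Laurent ring. -/
def skewLaurentContext (N : SubBimodule (ringB σ G H J) (ringB σ G' H J))
    (P : SubBimodule (ringB σ G' H J) (ringB σ G H J)) {K L : ℤ → Ideal R}
    (hN : N.space = SkewLaurent.ofIdeals σ K) (hP : P.space = SkewLaurent.ofIdeals σ L)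
    (hNP : ∀ x ∈ N.space, ∀ y ∈ P.space, x * y ∈ ringB σ G H J)
    (hPN : ∀ y ∈ P.space, ∀ x ∈ N.space, y * x ∈ ringB σ G' H J)
    (h1NP : (1 : SkewLaurent σ) ∈ AddSubgroup.closure (zeroDegreeProducts N.space P.space))
    (h1PN : (1 : SkewLaurent σ) ∈ AddSubgroup.closure (zeroDegreeProducts P.space N.space)) :
    GradedMoritaContext (ringB.grading σ G' H J) (ringB.grading σ G H J) N.Elt P.Elt where
  np := mulPairing N P hNP
  pn := mulPairing P N hPN
  np_smul_left b x y := Subtype.ext (mul_assoc b.1 x.1 y.1)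
  np_smul_right x b y := Subtype.ext (mul_assoc x.1 y.1 b.1).symm
  np_balanced x a y := Subtype.ext (mul_assoc x.1 a.1 y.1)
  pn_smul_left a y x := Subtype.ext (mul_assoc a.1 y.1 x.1)
  pn_smul_right y a x := Subtype.ext (mul_assoc y.1 x.1 a.1).symm
  pn_balanced y b x := Subtype.ext (mul_assoc y.1 b.1 x.1)
  np_smul x y x' := Subtype.ext (mul_assoc x.1 y.1 x'.1)
  pn_smul y x y' := Subtype.ext (mul_assoc y.1 x.1 y'.1)
  degN n := (SkewLaurent.homogeneous σ n).toAddSubgroup.comap N.incl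
  degP n := (SkewLaurent.homogeneous σ n).toAddSubgroup.comap P.incl
  iSup_degN := iSup_homogeneous_eq_top N hN
  iSup_degP := iSup_homogeneous_eq_top P hP
  smul_degN _ _ _ hb _ hx := SkewLaurent.mul_mem_homogeneous hb hx
  smul_degP _ _ _ ha _ hy := SkewLaurent.mul_mem_homogeneous ha hy
  np_mem _ _ _ hx _ hy := SkewLaurent.mul_mem_homogeneous hx hy
  pn_mem _ _ _ hy _ hx := SkewLaurent.mul_mem_homogeneous hy hx
  one_mem_np := one_mem_closure_mulPairing N P hNP h1NP
  one_mem_pn := one_mem_closure_mulPairing P N hPN h1PN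

end Context

end LonelyCycles

end

theorem mainTheorem5 {k : Type w} {R : Type u} [Field k] [CommRing R] [IsDomain R]
    [IsNoetherianRing R] [Algebra k R] (σ : R ≃ₐ[k] R)
    (Z : Set (PrimeSpectrum R)) (hZ : IsClosed Z) (hlonely : LonelyCycles.IsLonely σ Z)
    (G : LonelyCycles.Cycle) (hG : G.IsPleasantlyAlternating)
    (H J : Ideal R) (hH : PrimeSpectrum.zeroLocus (H : Set R) ⊆ Z)
    (hJ : PrimeSpectrum.zeroLocus (J : Set R) ⊆ Z) (i : ℤ) :
    ∃ D : LonelyCycles.Cycle, G = .pt i + .shift (-1) D - D ∧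
    ∃ (N : LonelyCycles.SubBimodule (LonelyCycles.ringB σ G H J)
          (LonelyCycles.ringB σ (.pt i) H J))
      (P : LonelyCycles.SubBimodule (LonelyCycles.ringB σ (.pt i) H J)
          (LonelyCycles.ringB σ G H J)),
      -- the explicit graded bimodules
      N.space = LonelyCycles.SkewLaurent.ofIdeals σ (fun n =>
        LonelyCycles.twoSidedIdeal σ H J ((LonelyCycles.Cycle.pt i).partialSum n - D)) ∧
      P.space = LonelyCycles.SkewLaurent.ofIdeals σ (fun n =>
        LonelyCycles.twoSidedIdeal σ H J
          ((LonelyCycles.Cycle.pt i).partialSum n + .shift (-n) D)) ∧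
      N.space * P.space = Subalgebra.toSubmodule (LonelyCycles.ringB σ G H J) ∧
      P.space * N.space = Subalgebra.toSubmodule (LonelyCycles.ringB σ (.pt i) H J) ∧
      -- `N` is isomorphic to a graded right ideal
      (∃ r : R, r ≠ 0 ∧ ∀ x ∈ N.space,
        LonelyCycles.SkewLaurent.monomial σ 0 r * x ∈ LonelyCycles.ringB σ (.pt i) H J) ∧
      -- `B(G, H, J)` is the endomorphism ring of `N`, and `P` is the dual of `N`
      Function.Bijective N.toEnd ∧
      (∀ f : N.Elt →ₗ[(LonelyCycles.ringB σ (.pt i) H J)ᵐᵒᵖ] LonelyCycles.ringB σ (.pt i) H J,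
        ∃! p : P.Elt, ∀ y : N.Elt,
          (f y : LonelyCycles.SkewLaurent σ) = P.incl p * N.incl y) ∧
      -- the graded Morita equivalence
      ∃ E : LonelyCycles.GradedMoritaEquivalence
          (LonelyCycles.ringB.grading σ (.pt i) H J) (LonelyCycles.ringB.grading σ G H J),
        E.IsImplementedBy N.Elt P.Elt
          (fun n => {x | N.incl x ∈ LonelyCycles.SkewLaurent.homogeneous σ n}) := by
  open LonelyCycles in
  obtain ⟨D, hGD, hge, hlt⟩ := hG.exists_eq_pt_add i
  subst hGD
  have hA (x : SkewLaurent σ) : x ∈ ringB σ (.pt i) H J ↔ x ∈ homSpace σ H J (.pt i) 0 0 := by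
    rw [← toSubmodule_ringB, Subalgebra.mem_toSubmodule]
  have hB (x : SkewLaurent σ) : x ∈ ringB σ (.pt i + .shift (-1) D - D) H J ↔
      x ∈ homSpace σ H J (.pt i) D D := by
    rw [← toSubmodule_ringB_add_shift_sub, Subalgebra.mem_toSubmodule]
  let N : SubBimodule (ringB σ (.pt i + .shift (-1) D - D) H J) (ringB σ (.pt i) H J) :=
    { space := homSpace σ H J (.pt i) D 0
      left_mem := fun b hb x hx => mul_mem_homSpace ((hB b).1 hb) hx
      right_mem := fun a ha x hx => mul_mem_homSpace hx ((hA a).1 ha) }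
  let P : SubBimodule (ringB σ (.pt i) H J) (ringB σ (.pt i + .shift (-1) D - D) H J) :=
    { space := homSpace σ H J (.pt i) 0 D
      left_mem := fun a ha x hx => mul_mem_homSpace ((hA a).1 ha) hx
      right_mem := fun b hb x hx => mul_mem_homSpace hx ((hB b).1 hb) }
  -- the coefficient of `(Zᵢ)_m` at `j` takes, as `m` varies, the values `0` and `1` if `i ≤ j`, and
  -- the values `0` and `-1` if `j < i`: these are the only values that `D` can have at `j`
  have h1NP := one_mem_closure_zeroDegreeProducts (G := .pt i) (X := D) (Y := 0) hlonely hH hJ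
    fun j => by
      rcases lt_or_ge j i with hj | hj
      · rcases hlt j hj with h | h
        · exact ⟨0, by simp [Cycle.partialSum_zero, h]⟩
        · exact ⟨j - i, by simp [Cycle.partialSum_pt_apply, h]; omega⟩
      · rcases hge j hj with h | h
        · exact ⟨0, by simp [Cycle.partialSum_zero, h]⟩
        · exact ⟨j - i + 1, by simp [Cycle.partialSum_pt_apply, h]; omega⟩
  -- for `m` of large absolute value and the right sign, the `j`-th coefficients of `(Zᵢ)_m` and
  -- of `σ⁻ᵐ(D)` both vanish
  have h1PN := one_mem_closure_zeroDegreeProducts (G := .pt i) (X := 0) (Y := D) hlonely hH hJ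
    fun j => by
      rcases lt_or_ge j i with hj | hj
      · obtain ⟨b, hb⟩ := D.support.bddBelow
        have hD : D (-(max 0 (j - b + 1)) + j) = 0 := by
          by_contra h
          have := hb (Finsupp.mem_support_iff.2 h)
          omega
        refine ⟨max 0 (j - b + 1), ?_⟩
        rw [Finsupp.sub_apply, Finsupp.add_apply, Cycle.shift_apply, hD,
          Cycle.partialSum_pt_apply, if_neg (by omega), if_neg (by omega)]
        rfl
      · obtain ⟨b, hb⟩ := D.support.bddAbove
        have hD : D (-(min 0 (j - b - 1)) + j) = 0 := by
          by_contra h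
          have := hb (Finsupp.mem_support_iff.2 h)
          omega
        refine ⟨min 0 (j - b - 1), ?_⟩
        rw [Finsupp.sub_apply, Finsupp.add_apply, Cycle.shift_apply, hD,
          Cycle.partialSum_pt_apply, if_pos hj, if_pos (by omega)]
        rfl
  have hNP : ∀ x ∈ N.space, ∀ y ∈ P.space, x * y ∈ ringB σ (.pt i + .shift (-1) D - D) H J :=
    fun x hx y hy => (hB _).2 (mul_mem_homSpace hx hy)
  have hPN : ∀ y ∈ P.space, ∀ x ∈ N.space, y * x ∈ ringB σ (.pt i) H J :=
    fun y hy x hx => (hA _).2 (mul_mem_homSpace hy hx)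
  let C := skewLaurentContext N P rfl rfl hNP hPN h1NP h1PN
  refine ⟨D, rfl, N, P, ?_, ?_, ?_, ?_, ?_, C.bijective_toModuleEnd, fun f => ?_,
    C.gradedMoritaEquivalence fun c x => Subtype.ext (Algebra.commutes c x.1).symm,
    C.gradedMoritaEquivalence_isImplementedBy _⟩
  · exact congrArg (SkewLaurent.ofIdeals σ) (funext fun n =>
      congrArg (twoSidedIdeal σ H J) (by ext l; simp))
  · exact congrArg (SkewLaurent.ofIdeals σ) (funext fun n =>
      congrArg (twoSidedIdeal σ H J) (by ext l; simp))
  · rw [toSubmodule_ringB_add_shift_sub]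
    exact homSpace_mul_homSpace h1NP
  · rw [toSubmodule_ringB]
    exact homSpace_mul_homSpace h1PN
  · obtain ⟨r, hr, hr0⟩ := Submodule.exists_mem_ne_zero_of_ne_bot (twoSidedIdeal_ne_bot σ
      (hlonely.ne_bot hH) (hlonely.ne_bot hJ)
      ((Cycle.pt i).partialSum 0 + Cycle.shift (-0) D - 0))
    exact ⟨r, hr0, fun x hx => hPN _ (SkewLaurent.monomial_mem_ofIdeals hr) x hx⟩
  · obtain ⟨p, hp, hu⟩ := C.existsUnique_pn f
    exact ⟨p, fun y => congrArg Subtype.val (hp y), fun q hq => hu q fun y => Subtype.ext (hq y)⟩
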